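/- Let $M$ be a (Hausdorff, $\sigma$-compact) smooth manifold of dimension $n$, $\mathcal TM$ its bundle of nonzero tangent vectors, $J=\frac{\partial}{\partial y^i}\otimes dx^i$ the almost-tangent structure and $\mathcal C=y^i\frac{\partial}{\partial y^i}$ the Liouville field. A spray is a smooth vector field $S$ on $\mathcal TM$ with $JS=\mathcal C$ and $[\mathcal C,S]=S$; its horizontal and vertical projectors are $h=\frac12(\mathrm{Id}+[J,S])$, $v=\frac12(\mathrm{Id}-[J,S])$, where $[J,S]X=[JX,S]-J[X,S]$, and a vector field $X$ on $\mathcal TM$ is horizontal if $hX=X$. The holonomy distribution $\mathcal Hol$ of $S$ is spanned at each point by the values of all smooth horizontal vector fields on $\mathcal TM$ and their iterated Lie brackets $[X_1,[\dots[X_{m-1},X_m]\dots]]$; it is regular if its dimension is constant on $\mathcal TM$. Its vertical part is $\mathcal V_{\mathcal Hol}=\mathcal Hol\cap\mathcal V$, where $\mathcal V$ is the vertical distribution (equivalently, $v(\mathcal Hol)$). For an open set $U\subseteq\mathcal TM$, let $\mathcal F_S(U)$ be the set of Finsler functions on $U$ with geodesic spray $S$, i.e. of functions $F$ that are smooth and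 positive on $U$, satisfy $\mathcal C F=F$, are such that $E=\frac12F^2$ has metric tensor $\big(\frac{\partial^2E}{\partial y^i\partial y^j}\big)$ of rank $n$ at each point of $U$, and satisfy $i_S\,dd_JE=d(E-\mathcal CE)$ on $U$. For $F\in\mathcal F_S(U)$ let $\mathcal V_F$ be the image of $v_F=v-\frac{d_vF}{F}\otimes\mathcal C$. Theorem. Let $S$ be a metrizable spray on $M$ (there is a continuous function $F$ on $TM$ whose restriction to $\mathcal TM$ lies in $\mathcal F_S(\mathcal TM)$) with regular holonomy distribution. Then the vertical part of the holonomy distribution is the intersection of the distributions $\mathcal V_F$ of the (locally defined) Finsler functions $F$ of $S$: for every $u\in\mathcal TM$, $$\mathcal V_{\mathcal Hol}(u)=\bigcap_{U\ni u\text{ open in }\mathcal TM}\ \bigcap_{F\in\mathcal F_S(U)}\mathcal V_F(u).$$ -/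

import Mathlib

open scoped Manifold ContDiff

noncomputable section

namespace SprayGeometry

/-- The total space `TM` of the tangent bundle of an `n`-dimensional smooth manifold. -/
abbrev TanB (n : ℕ) (M : Type*) [TopologicalSpace M] [ChartedSpace (EuclideanSpace ℝ (Fin n)) M]
    [IsManifold (𝓡 n) ∞ M] : Type _ :=
  TangentBundle (𝓡 n) M

/-- Vector fields on `TM` (sections of `TTM`); only their values on the nonzero vectors, where
smoothness is required, are used. -/
abbrev VF (n : ℕ) (M : Type*) [TopologicalSpace M] [ChartedSpace (EuclideanSpace ℝ (Fin n)) M]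
    [IsManifold (𝓡 n) ∞ M] : Type _ :=
  (u : TanB n M) → TangentSpace (𝓡 n).tangent u

variable {n : ℕ} {M : Type*} [TopologicalSpace M] [ChartedSpace (EuclideanSpace ℝ (Fin n)) M]
  [IsManifold (𝓡 n) ∞ M]

/-- The slit tangent bundle, the set of nonzero tangent vectors. -/
def slit (n : ℕ) (M : Type*) [TopologicalSpace M] [ChartedSpace (EuclideanSpace ℝ (Fin n)) M]
    [IsManifold (𝓡 n) ∞ M] : Set (TanB n M) :=
  {u | u.2 ≠ 0}

/-- The vector field `X` is smooth on the set `U`. -/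
def SmoothVFOn (U : Set (TanB n M)) (X : VF n M) : Prop :=
  ContMDiffOn (𝓡 n).tangent (𝓡 n).tangent.tangent ∞
    (fun u => (⟨u, X u⟩ : TangentBundle (𝓡 n).tangent (TanB n M))) U

/-- The vector field `X` is smooth at the point `u`. -/
def SmoothVFAt (u : TanB n M) (X : VF n M) : Prop :=
  ContMDiffAt (𝓡 n).tangent (𝓡 n).tangent.tangent ∞
    (fun u => (⟨u, X u⟩ : TangentBundle (𝓡 n).tangent (TanB n M))) u

/-- Lie bracket of vector fields on `TM`. -/
def bracket (X Y : VF n M) : VF n M :=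
  VectorField.mlieBracket (𝓡 n).tangent X Y

/-- The derivative `X f` of a function along a vector field. -/
def lieD (X : VF n M) (f : TanB n M → ℝ) : TanB n M → ℝ :=
  fun u => (mfderiv (𝓡 n).tangent 𝓘(ℝ, ℝ) f u (X u) : ℝ)

/-- The differential of the projection `TM → M` at `u`. -/
def dProj (u : TanB n M) :
    TangentSpace (𝓡 n).tangent u →L[ℝ] TangentSpace (𝓡 n) u.1 :=
  mfderiv (𝓡 n).tangent (𝓡 n) (fun w : TanB n M => w.1) u

/-- The vertical space at `u`. -/
def vertical (u : TanB n M) : Submodule ℝ (TangentSpace (𝓡 n).tangent u) :=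
  LinearMap.ker (dProj u).toLinearMap

/-- The vertical lift at `u ∈ T_xM`: the differential at `u` of the inclusion of the vector space
`T_xM` (whose underlying vector space in Mathlib is the model space) as a fibre of `TM`. -/
def vertLift (u : TanB n M) :
    TangentSpace (𝓡 n) u.1 →L[ℝ] TangentSpace (𝓡 n).tangent u :=
  mfderiv 𝓘(ℝ, EuclideanSpace ℝ (Fin n)) (𝓡 n).tangent
    (fun w : EuclideanSpace ℝ (Fin n) => (⟨u.1, w⟩ : TanB n M)) u.2

/-- The almost-tangent structure `J = ∂/∂yⁱ ⊗ dxⁱ`, acting on vector fields. -/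
def J (X : VF n M) : VF n M :=
  fun u => vertLift u (dProj u (X u))

/-- The Liouville vector field `C = yⁱ ∂/∂yⁱ`. -/
def liouville : VF n M :=
  fun u => vertLift u u.2

/-- Sprays: smooth vector fields `S` on the slit tangent bundle with `J S = C`, `[C, S] = S`. -/
structure IsSpray (S : VF n M) : Prop where
  smooth : SmoothVFOn (slit n M) S
  J_eq : ∀ u ∈ slit n M, J S u = liouville u
  homogeneous : ∀ u ∈ slit n M, bracket liouville S u = S u

/-- `Γ = [J, S]`, the canonical connection of a spray:
the Frölicher–Nijenhuis bracket `[J, S] X = [J X, S] - J [X, S]`. -/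
def Gam (S X : VF n M) : VF n M :=
  bracket (J X) S - J (bracket X S)

/-- The horizontal projector `h = (Id + [J, S]) / 2`, acting on vector fields. -/
def hProj (S X : VF n M) : VF n M :=
  (1 / 2 : ℝ) • (X + Gam S X)

/-- The vertical projector `v = (Id - [J, S]) / 2`, acting on vector fields. -/
def vProj (S X : VF n M) : VF n M :=
  (1 / 2 : ℝ) • (X - Gam S X)

/-- Horizontal vector fields on the slit tangent bundle. -/
structure IsHorizontal (S X : VF n M) : Prop where
  smooth : SmoothVFOn (slit n M) X
  h_eq : ∀ u ∈ slit n M, hProj S X u = X u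

/-- Iterated brackets `[X₁, [X₂, … [Xₘ₋₁, Xₘ]…]]` (with `m ≥ 1`) of horizontal vector fields. -/
inductive IsHolGenerator (S : VF n M) : VF n M → Prop
  | horizontal (X : VF n M) : IsHorizontal S X → IsHolGenerator S X
  | bracket (X Y : VF n M) : IsHorizontal S X → IsHolGenerator S Y →
      IsHolGenerator S (bracket X Y)

/-- The holonomy distribution of `S` at `u`. -/
def hol (S : VF n M) (u : TanB n M) : Submodule ℝ (TangentSpace (𝓡 n).tangent u) :=
  Submodule.span ℝ {ξ | ∃ X : VF n M, IsHolGenerator S X ∧ X u = ξ}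

/-- The holonomy distribution is regular: it has constant rank on the slit tangent bundle. -/
def HolRegular (S : VF n M) : Prop :=
  ∃ k : ℕ, ∀ u ∈ slit n M, Module.finrank ℝ (hol S u) = k

/-- The vertical part of the holonomy distribution at `u`. As the holonomy distribution contains
the horizontal one, this is also its image under the vertical projector. -/
def holVert (S : VF n M) (u : TanB n M) : Submodule ℝ (TangentSpace (𝓡 n).tangent u) :=
  hol S u ⊓ vertical u

/-- The energy `F² / 2`. -/
def energy (F : TanB n M → ℝ) : TanB n M → ℝ :=
  fun u => 1 / 2 * F u ^ 2

/-- The metric tensor `∂²E/∂yⁱ∂yʲ` at `u ∈ T_xM` of a function `E` on `TM`: the second derivative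
at `u` of the restriction of `E` to the vector space `T_xM`. -/
def fibreHessian (E : TanB n M → ℝ) (u : TanB n M)
    (w₁ w₂ : EuclideanSpace ℝ (Fin n)) : ℝ :=
  fderiv ℝ (fderiv ℝ fun w : EuclideanSpace ℝ (Fin n) => E (⟨u.1, w⟩ : TanB n M)) u.2 w₁ w₂

/-- `F` is a Finsler function on the set `U` of nonzero tangent vectors: smooth and positive on
`U`, `1`-homogeneous (`C F = F`), with metric tensor of rank `n`. -/
structure IsFinslerOn (U : Set (TanB n M)) (F : TanB n M → ℝ) : Prop where
  smooth : ContMDiffOn (𝓡 n).tangent 𝓘(ℝ, ℝ) ∞ F U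
  pos : ∀ u ∈ U, 0 < F u
  homogeneous : ∀ u ∈ U, lieD liouville F u = F u
  nondegenerate : ∀ u ∈ U, ∀ w₁, (∀ w₂, fibreHessian (energy F) u w₁ w₂ = 0) → w₁ = 0

/-- The semibasic 1-form `d_J E`, evaluated on `X`: `(d_J E)(X) = dE(J X)`. -/
def dJ (E : TanB n M → ℝ) (X : VF n M) : TanB n M → ℝ :=
  lieD (J X) E

/-- The 2-form `d d_J E`, evaluated on the vector fields `X`, `Y`. -/
def ddJ (E : TanB n M → ℝ) (X Y : VF n M) : TanB n M → ℝ :=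
  lieD X (dJ E Y) - lieD Y (dJ E X) - dJ E (bracket X Y)

/-- The Euler–Lagrange equation `i_S d d_J E - d(E - C E) = 0` on `U`, tested on vector fields. -/
def EulerLagrangeOn (U : Set (TanB n M)) (S : VF n M) (E : TanB n M → ℝ) : Prop :=
  ∀ u ∈ U, ∀ X : VF n M, SmoothVFAt u X →
    ddJ E S X u - lieD X (E - lieD liouville E) u = 0

/-- The Finsler functions on `U` whose geodesic spray (on `U`) is `S`. -/
def finslerFunctions (S : VF n M) (U : Set (TanB n M)) : Set (TanB n M → ℝ) :=
  {F | IsFinslerOn U F ∧ EulerLagrangeOn U S (energy F)}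

/-- `S` is Finsler metrizable: it is the geodesic spray of a Finsler function on all of `TM`. -/
def IsMetrizable (S : VF n M) : Prop :=
  ∃ F : TanB n M → ℝ, Continuous F ∧ F ∈ finslerFunctions S (slit n M)

/-- The endomorphism `v_F = v - (d_v F / F) ⊗ C`, acting on vector fields. -/
def vProjF (S : VF n M) (F : TanB n M → ℝ) (X : VF n M) : VF n M :=
  fun u => vProj S X u - (lieD (vProj S X) F u / F u) • (liouville u : TangentSpace _ u)

/-- The distribution `𝒱_F = Im v_F` at `u`. -/
def distV (S : VF n M) (F : TanB n M → ℝ) (u : TanB n M) :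
    Submodule ℝ (TangentSpace (𝓡 n).tangent u) :=
  Submodule.span ℝ {ξ | ∃ X : VF n M, SmoothVFAt u X ∧ vProjF S F X u = ξ}

end SprayGeometry

end

/-! Since dF(C) = F, the image of v_F at u consists of the vertical vectors killed by dF
(`mem_distV_iff`). The theorem therefore says that a vertical vector belongs to the holonomy
distribution exactly when it is killed by the differentials of all local Finsler functions of S.

One inclusion: the Euler–Lagrange equation and the 2-homogeneity of E force dE = F dF to vanish on
horizontal vectors (`IsLocalSpray.horizontal_of_eulerLagrange`). A function constant along X and Y
is constant along [X, Y], so dF vanishes on all of Hol (`hol_le_ker_dFun`).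

Other inclusion: let F₀ metrize S and let ξ ∉ Hol(u) satisfy dF₀(ξ) = 0. By the Jacobi identity Hol
is involutive (`IsHolGenerator.bracket_holField`) and stable under bracket with C
(`IsHolGenerator.bracket_liouville`). As dF₀ vanishes on Hol while dF₀(C) = F₀ > 0, the sum Hol ⊕
⟨C⟩ is direct; it is involutive, has constant rank by regularity, and does not contain ξ. Frobenius
(`exists_firstIntegral`) gives g with g(u) = 0, dg = 0 on Hol and on C, and dg(ξ) ≠ 0. Then F = F₀(1
+ εg) is again 1-homogeneous and constant along horizontal curves, hence solves the Euler–Lagrange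
equation (`IsLocalSpray.eulerLagrange_of_horizontal`). For small ε ≠ 0 it is positive and
nondegenerate near u (`exists_perturbation`), and dF(ξ) = ε F₀ dg(ξ) ≠ 0, so ξ is not in V_F(u).

Frobenius itself is proved for a distribution written as the graph of A : E₁ × E₂ → L(E₁, E₂). The
point (x, y) is transported inside its leaf along the ray t ↦ tx down to x = 0, and the
E₂-coordinate reached there is the first integral. Smooth dependence of the path on (x, y) comes
from the implicit function theorem in the Banach space C([0,1], E₂). -/

noncomputable section

open Set Filter Topology

universe u

namespace ContinuousMap

/-! ### Smoothness of superposition operators on spaces of continuous maps. -/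

section Superposition

variable {K : Type*} [TopologicalSpace K] [CompactSpace K]

/-- Pointwise application of a continuous family of operators to a continuous family of vectors,
as a bounded bilinear map. -/
def clmApplyL (K E F : Type*) [TopologicalSpace K] [CompactSpace K]
    [NormedAddCommGroup E] [NormedSpace ℝ E] [NormedAddCommGroup F] [NormedSpace ℝ F] :
    C(K, E →L[ℝ] F) →L[ℝ] C(K, E) →L[ℝ] C(K, F) :=
  LinearMap.mkContinuous₂
    (LinearMap.mk₂ ℝ
      (fun (A : C(K, E →L[ℝ] F)) (η : C(K, E)) => (⟨fun k => A k (η k), by fun_prop⟩ : C(K, F)))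
      (fun _ _ _ => by ext; simp) (fun _ _ _ => by ext; simp)
      (fun _ _ _ => by ext; simp) (fun _ _ _ => by ext; simp)) 1
    (fun A η => by
      rw [ContinuousMap.norm_le _ (by positivity)]
      intro k
      simp only [LinearMap.mk₂_apply, ContinuousMap.coe_mk, one_mul]
      exact (A k).le_of_opNorm_le_of_le (A.norm_coe_le_norm k) (η.norm_coe_le_norm k))

@[simp] theorem clmApplyL_apply {E F : Type*}
    [NormedAddCommGroup E] [NormedSpace ℝ E] [NormedAddCommGroup F] [NormedSpace ℝ F]
    (A : C(K, E →L[ℝ] F)) (η : C(K, E)) (k : K) : clmApplyL K E F A η k = A k (η k) := rfl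

/-- The derivative acts pointwise. The remainder is uniform in k because composing with G' is
continuous for the sup norm over the compact K; the mean value inequality on a ball around η k then
bounds it. -/
theorem hasFDerivAt_comp_left {E F : Type*}
    [NormedAddCommGroup E] [NormedSpace ℝ E] [NormedAddCommGroup F] [NormedSpace ℝ F]
    (G : C(E, F)) (G' : C(E, E →L[ℝ] F)) (hG : ∀ x, HasFDerivAt G (G' x) x) (η : C(K, E)) :
    HasFDerivAt (fun θ : C(K, E) => G.comp θ) (clmApplyL K E F (G'.comp η)) η := by
  rw [hasFDerivAt_iff_isLittleO_nhds_zero, Asymptotics.isLittleO_iff]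
  intro ε hε
  have hc : Continuous fun θ : C(K, E) => G'.comp (η + θ) :=
    (ContinuousMap.continuous_postcomp G').comp (by fun_prop)
  have h0 : ∀ᶠ θ in 𝓝 (0 : C(K, E)), dist (G'.comp (η + θ)) (G'.comp (η + 0)) < ε :=
    Metric.continuous_iff'.1 hc 0 ε hε
  obtain ⟨δ, hδ, hb⟩ := Metric.eventually_nhds_iff.1 h0
  -- Testing the sup-norm continuity on constant perturbations gives a modulus of continuity for G'
  -- that is uniform along the image of η.
  have key : ∀ k : K, ∀ w : E, ‖w‖ < δ → ‖G' (η k + w) - G' (η k)‖ ≤ ε := by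
    intro k w hw
    have h1 : dist (ContinuousMap.const K w) (0 : C(K, E)) < δ := by
      rw [ContinuousMap.dist_lt_iff hδ]
      intro; simpa using hw
    have h2 := (ContinuousMap.dist_lt_iff hε).1 (hb h1) k
    simp only [ContinuousMap.comp_apply, ContinuousMap.add_apply, ContinuousMap.const_apply,
      add_zero] at h2
    rw [dist_eq_norm] at h2
    exact h2.le
  filter_upwards [Metric.ball_mem_nhds (0 : C(K, E)) hδ] with θ hθ
  have hθ' : ∀ k, ‖θ k‖ < δ := fun k =>
    (θ.norm_coe_le_norm k).trans_lt (by simpa using hθ)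
  rw [ContinuousMap.norm_le _ (by positivity)]
  intro k
  have := (convex_ball (η k) δ).norm_image_sub_le_of_norm_hasFDerivWithin_le'
    (f := G) (f' := fun x => G' x) (φ := G' (η k)) (C := ε) (x := η k) (y := η k + θ k)
    (fun x _ => (hG x).hasFDerivWithinAt)
    (fun x hx => by
      have := key k (x - η k) (by simpa [dist_eq_norm] using hx)
      simpa using this)
    (by simpa using hδ) (by simpa using hθ' k)
  simp only [add_sub_cancel_left] at this
  refine (this.trans ?_)
  gcongr
  exact θ.norm_coe_le_norm k

/-- The derivative is the superposition operator of G' followed by a bounded linear map, so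
smoothness follows by induction. The induction replaces F by E →L[ℝ] F, whence the quantifier over F
and the common universe. -/
theorem contDiff_comp_left_nat {E : Type u} [NormedAddCommGroup E] [NormedSpace ℝ E] (n : ℕ) :
    ∀ {F : Type u} [NormedAddCommGroup F] [NormedSpace ℝ F] (G : C(E, F)), ContDiff ℝ n G →
      ContDiff ℝ n (fun θ : C(K, E) => G.comp θ) := by
  induction n with
  | zero =>
    intro F _ _ G _
    exact contDiff_zero.2 (ContinuousMap.continuous_postcomp G)
  | succ n ih =>
    intro F _ _ G hG
    have hG1 : ContDiff ℝ n (fderiv ℝ G) := hG.fderiv_right (by norm_cast)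
    let G' : C(E, E →L[ℝ] F) := ⟨fderiv ℝ G, hG1.continuous⟩
    have hd : ∀ x, HasFDerivAt G (G' x) x := fun x =>
      (hG.differentiable (by norm_cast) x).hasFDerivAt
    push_cast
    rw [contDiff_succ_iff_hasFDerivAt]
    refine ⟨fun η => clmApplyL K E F (G'.comp η), ?_, fun η => hasFDerivAt_comp_left G G' hd η⟩
    exact (clmApplyL K E F).contDiff.comp (ih G' hG1)

theorem contDiff_comp_left {E F : Type u} [NormedAddCommGroup E] [NormedSpace ℝ E]
    [NormedAddCommGroup F] [NormedSpace ℝ F] (G : C(E, F)) (hG : ContDiff ℝ ∞ G) :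
    ContDiff ℝ ∞ (fun θ : C(K, E) => G.comp θ) :=
  contDiff_infty.2 fun n => contDiff_comp_left_nat n G (hG.of_le (by exact_mod_cast le_top))

end Superposition

end ContinuousMap

/-- Inverse function theorem for Ψ(x, y) = (x, Φ(x, y)). The partial derivative of Φ in y being the
identity, the inverse of DΨ can be written explicitly as (x, w) ↦ (x, w - L(x, 0)). -/
theorem exists_contDiffOn_implicit {X Y : Type*} [NormedAddCommGroup X] [NormedSpace ℝ X]
    [CompleteSpace X] [NormedAddCommGroup Y] [NormedSpace ℝ Y] [CompleteSpace Y]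
    {Φ : X × Y → Y} (hΦ : ContDiff ℝ ∞ Φ) {x₀ : X} {y₀ : Y} (h0 : Φ (x₀, y₀) = 0)
    (hd : ∀ v, fderiv ℝ Φ (x₀, y₀) (0, v) = v) :
    ∃ (O : Set X) (η : X → Y), IsOpen O ∧ x₀ ∈ O ∧ ContDiffOn ℝ ∞ η O ∧ η x₀ = y₀ ∧
      ∀ x ∈ O, Φ (x, η x) = 0 := by
  let Ψ : X × Y → X × Y := fun z => (z.1, Φ z)
  have hΨ : ContDiff ℝ ∞ Ψ := contDiff_fst.prodMk hΦ
  have hΨd : ∀ z, HasFDerivAt Ψ ((ContinuousLinearMap.fst ℝ X Y).prod (fderiv ℝ Φ z)) z := fun z =>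
    hasFDerivAt_fst.prodMk (hΦ.differentiable (by simp) z).hasFDerivAt
  set L := fderiv ℝ Φ (x₀, y₀) with hL
  have hLx : ∀ z : X × Y, L z = L (z.1, 0) + z.2 := fun z => by
    conv_lhs => rw [show z = (z.1, 0) + (0, z.2) by simp]
    rw [map_add, hd]
  let e : (X × Y) ≃L[ℝ] (X × Y) := ContinuousLinearEquiv.equivOfInverse
    ((ContinuousLinearMap.fst ℝ X Y).prod L)
    ((ContinuousLinearMap.fst ℝ X Y).prod (ContinuousLinearMap.snd ℝ X Y -
      L.comp ((ContinuousLinearMap.inl ℝ X Y).comp (ContinuousLinearMap.fst ℝ X Y))))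
    (fun z => by
      have := hLx z
      ext <;> simp [this]) (fun z => by
      have := hLx (z.1, z.2 - L (z.1, 0))
      ext <;> simp [this])
  have he : HasFDerivAt Ψ (e : X × Y →L[ℝ] X × Y) (x₀, y₀) := hΨd _
  let P := hΨ.contDiffAt.toOpenPartialHomeomorph Ψ he (by simp)
  have hP : (P : X × Y → X × Y) = Ψ := rfl
  let R : Set (X × Y) :=
    {z | fderiv ℝ Ψ z ∈ range ((↑) : ((X × Y) ≃L[ℝ] (X × Y)) → (X × Y →L[ℝ] X × Y))}
  have hR : IsOpen R := ContinuousLinearEquiv.isOpen.preimage (hΨ.continuous_fderiv (by simp))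
  have hmem : (x₀, y₀) ∈ P.source :=
    hΨ.contDiffAt.mem_toOpenPartialHomeomorph_source he (by simp)
  have hx0 : P (x₀, y₀) = (x₀, 0) := by rw [hP]; simp [Ψ, h0]
  -- Smoothness of the local inverse is known only at points where DΨ is invertible; invertible
  -- operators being open, it suffices to shrink the target.
  let O' : Set (X × Y) := P.target ∩ P.symm ⁻¹' R
  have hO' : IsOpen O' := P.isOpen_inter_preimage_symm hR
  have hs : ContDiffOn ℝ ∞ P.symm O' := by
    rintro z ⟨hz1, e', he'⟩
    refine (P.contDiffAt_symm hz1 (f₀' := e') ?_ hΨ.contDiffAt).contDiffWithinAt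
    rw [he']
    exact (hΨ.differentiable (by simp) _).hasFDerivAt
  refine ⟨(fun x => (x, (0 : Y))) ⁻¹' O', fun x => (P.symm (x, 0)).2, hO'.preimage (by fun_prop),
    ?_, ?_, ?_, ?_⟩
  · change (x₀, (0 : Y)) ∈ O'
    rw [← hx0]
    refine ⟨P.map_source hmem, ?_⟩
    rw [mem_preimage, P.left_inv hmem]
    exact ⟨e, he.fderiv.symm⟩
  · exact contDiff_snd.comp_contDiffOn (hs.comp (by fun_prop) fun x hx => hx)
  · simp only [← hx0, P.left_inv hmem]
  · intro x hx
    have h := P.right_inv hx.1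
    rw [hP] at h
    have h1 : (P.symm (x, 0)).1 = x := congrArg Prod.fst h
    have h2 : Φ (P.symm (x, 0)) = 0 := congrArg Prod.snd h
    rwa [← show P.symm (x, 0) = (x, (P.symm (x, 0)).2) from Prod.ext h1 rfl]

/-! ### Frobenius theorem for graphs, by transport along rays. -/

section Leaf

/-- The primitive vanishing at `1` of a continuous function on `[0, 1]`. -/
def primitiveL (F : Type*) [NormedAddCommGroup F] [NormedSpace ℝ F] :
    C(Icc (0 : ℝ) 1, F) →L[ℝ] C(Icc (0 : ℝ) 1, F) :=
  LinearMap.mkContinuous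
    { toFun := fun h => ⟨fun t => ∫ s in (1 : ℝ)..t, IccExtend zero_le_one h s,
        (intervalIntegral.continuous_primitive
          (fun a b => (h.continuous.Icc_extend' (h := zero_le_one)).intervalIntegrable a b) 1).comp
          continuous_subtype_val⟩
      map_add' := fun h k => by
        ext t
        simp only [ContinuousMap.coe_mk, ContinuousMap.add_apply]
        rw [← intervalIntegral.integral_add
          (h.continuous.Icc_extend' (h := zero_le_one) |>.intervalIntegrable _ _)
          (k.continuous.Icc_extend' (h := zero_le_one) |>.intervalIntegrable _ _)]
        rfl
      map_smul' := fun c h => by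
        ext t
        simp only [ContinuousMap.coe_mk, ContinuousMap.smul_apply, RingHom.id_apply]
        rw [← intervalIntegral.integral_smul]
        rfl } 1
    (fun h => by
      rw [ContinuousMap.norm_le _ (by positivity)]
      intro t
      refine (intervalIntegral.norm_integral_le_of_norm_le_const (C := ‖h‖)
        fun s _ => h.norm_coe_le_norm _).trans ?_
      rw [one_mul]
      refine mul_le_of_le_one_right (norm_nonneg _) ?_
      rw [abs_le]
      constructor <;> linarith [t.2.1, t.2.2])

theorem primitiveL_apply {F : Type*} [NormedAddCommGroup F] [NormedSpace ℝ F]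
    (h : C(Icc (0 : ℝ) 1, F)) (t : Icc (0 : ℝ) 1) :
    primitiveL F h t = ∫ s in (1 : ℝ)..t, IccExtend zero_le_one h s := rfl

variable {E₁ E₂ : Type u} [NormedAddCommGroup E₁] [NormedSpace ℝ E₁]
  [NormedAddCommGroup E₂] [NormedSpace ℝ E₂]

/-- The linear map sending `((x, y), η)` to the path `t ↦ (t x, η t, x)`. -/
def rayL (E₁ E₂ : Type*) [NormedAddCommGroup E₁] [NormedSpace ℝ E₁]
    [NormedAddCommGroup E₂] [NormedSpace ℝ E₂] :
    ((E₁ × E₂) × C(Icc (0 : ℝ) 1, E₂)) →L[ℝ] C(Icc (0 : ℝ) 1, (E₁ × E₂) × E₁) :=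
  LinearMap.mkContinuous
    { toFun := fun z => ⟨fun t => (((t : ℝ) • z.1.1, z.2 t), z.1.1), by fun_prop⟩
      map_add' := fun _ _ => by ext <;> simp
      map_smul' := fun _ _ => by ext <;> simp [smul_smul, mul_comm] } 1
    (fun z => by
      rw [ContinuousMap.norm_le _ (by positivity), one_mul]
      intro t
      have h1 : ‖z.1.1‖ ≤ ‖z‖ := (norm_fst_le _).trans (norm_fst_le _)
      refine norm_prod_le_iff.2 ⟨norm_prod_le_iff.2 ⟨?_, ?_⟩, h1⟩
      · refine (norm_smul_le _ _).trans ?_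
        refine (mul_le_of_le_one_left (norm_nonneg _) ?_).trans h1
        rw [Real.norm_eq_abs, abs_le]
        constructor <;> linarith [t.2.1, t.2.2]
      · exact (z.2.norm_coe_le_norm t).trans (norm_snd_le _))

@[simp] theorem rayL_apply (z : (E₁ × E₂) × C(Icc (0 : ℝ) 1, E₂)) (t : Icc (0 : ℝ) 1) :
    rayL E₁ E₂ z t = (((t : ℝ) • z.1.1, z.2 t), z.1.1) := rfl

theorem fderiv_eval_clm {A : E₁ × E₂ → E₁ →L[ℝ] E₂} (hA : ContDiff ℝ ∞ A)
    (z : (E₁ × E₂) × E₁) (w : (E₁ × E₂) × E₁) :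
    fderiv ℝ (fun q : (E₁ × E₂) × E₁ => A q.1 q.2) z w = fderiv ℝ A z.1 w.1 z.2 + A z.1 w.2 := by
  have h1 : HasFDerivAt (fun q : (E₁ × E₂) × E₁ => A q.1)
      ((fderiv ℝ A z.1).comp (ContinuousLinearMap.fst ℝ _ _)) z :=
    (hA.differentiable (by simp) z.1).hasFDerivAt.comp z hasFDerivAt_fst
  rw [(h1.clm_apply hasFDerivAt_snd).fderiv]
  simp [add_comm]

variable [CompleteSpace E₁] [CompleteSpace E₂]

/-- η z is the path with t ↦ (tx, η z t) tangent to the graph of A and equal to (x, y) at t = 1; the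
integral equation is solved by the implicit function theorem at z = 0. The last clause is the
linearised equation, got by differentiating Φ(z, η z) = 0. -/
theorem exists_leaf_path {A : E₁ × E₂ → E₁ →L[ℝ] E₂} (hA : ContDiff ℝ ∞ A) :
    ∃ (O : Set (E₁ × E₂)) (η : E₁ × E₂ → C(Icc (0 : ℝ) 1, E₂)),
      IsOpen O ∧ 0 ∈ O ∧ ContDiffOn ℝ ∞ η O ∧ η 0 = 0 ∧
      (∀ z ∈ O, ∀ t, η z t = z.2 + ∫ s in (1 : ℝ)..t,
        IccExtend zero_le_one (fun s : Icc (0 : ℝ) 1 => A ((s : ℝ) • z.1, η z s) z.1) s) ∧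
      (∀ z ∈ O, ∀ w, ∀ t, fderiv ℝ η z w t = w.2 + ∫ s in (1 : ℝ)..t,
        IccExtend zero_le_one (fun s : Icc (0 : ℝ) 1 =>
          fderiv ℝ A ((s : ℝ) • z.1, η z s) ((s : ℝ) • w.1, fderiv ℝ η z w s) z.1
            + A ((s : ℝ) • z.1, η z s) w.1) s) := by
  have hGs : ContDiff ℝ ∞ (fun q : (E₁ × E₂) × E₁ => A q.1 q.2) :=
    (hA.comp contDiff_fst).clm_apply contDiff_snd
  let G : C((E₁ × E₂) × E₁, E₂) := ⟨fun q => A q.1 q.2, hGs.continuous⟩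
  let G' : C((E₁ × E₂) × E₁, (E₁ × E₂) × E₁ →L[ℝ] E₂) :=
    ⟨fderiv ℝ G, hGs.continuous_fderiv (by simp)⟩
  have hG' : ∀ x, HasFDerivAt G (G' x) x := fun x =>
    (hGs.differentiable (by simp) x).hasFDerivAt
  let cst : E₂ →L[ℝ] C(Icc (0 : ℝ) 1, E₂) := ContinuousLinearMap.const ℝ (Icc (0 : ℝ) 1)
  let Φ : (E₁ × E₂) × C(Icc (0 : ℝ) 1, E₂) → C(Icc (0 : ℝ) 1, E₂) := fun z =>
    z.2 - cst z.1.2 - primitiveL E₂ (G.comp (rayL E₁ E₂ z))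
  have hΦ : ContDiff ℝ ∞ Φ := by
    refine (contDiff_snd.sub (cst.contDiff.comp (contDiff_snd.comp contDiff_fst))).sub ?_
    exact (primitiveL E₂).contDiff.comp
      ((ContinuousMap.contDiff_comp_left G hGs).comp (rayL E₁ E₂).contDiff)
  have hΦd : ∀ z w, fderiv ℝ Φ z w = w.2 - cst w.1.2 - primitiveL E₂
      (ContinuousMap.clmApplyL _ _ _ (G'.comp (rayL E₁ E₂ z)) (rayL E₁ E₂ w)) := by
    intro z w
    have h1 : HasFDerivAt (fun z => G.comp (rayL E₁ E₂ z)) _ z :=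
      (ContinuousMap.hasFDerivAt_comp_left G G' hG' (rayL E₁ E₂ z)).comp z
        (rayL E₁ E₂).hasFDerivAt
    have h2 : HasFDerivAt Φ _ z := ((hasFDerivAt_snd).sub ((cst.comp
      ((ContinuousLinearMap.snd ℝ E₁ E₂).comp (ContinuousLinearMap.fst ℝ _ _))).hasFDerivAt)).sub
      ((primitiveL E₂).hasFDerivAt.comp z h1)
    rw [h2.fderiv]
    rfl
  have hΦ0 : Φ (0, 0) = 0 := by
    ext t
    simp only [Φ, cst, ContinuousMap.sub_apply, primitiveL_apply]
    have : (IccExtend zero_le_one (G.comp (rayL E₁ E₂ (0, 0))) : ℝ → E₂) = fun _ => 0 := by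
      ext s; simp [IccExtend, G]
    rw [this]
    simp
  -- At x = 0 the integrand A(·)x vanishes for every path, so the integral term has zero derivative
  -- in the direction of the path.
  have hΦd0 : ∀ v, fderiv ℝ Φ (0, 0) (0, v) = v := by
    intro v
    rw [hΦd]
    have : ContinuousMap.clmApplyL _ _ _ (G'.comp (rayL E₁ E₂ (0, 0))) (rayL E₁ E₂ (0, v)) = 0 := by
      ext s
      simp only [ContinuousMap.clmApplyL_apply, ContinuousMap.comp_apply]
      change fderiv ℝ (fun q : (E₁ × E₂) × E₁ => A q.1 q.2) _ _ = 0
      rw [fderiv_eval_clm hA]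
      simp
    rw [this]
    simp
  obtain ⟨O, η, hO, h0, hη, hη0, hsol⟩ := exists_contDiffOn_implicit hΦ hΦ0 hΦd0
  refine ⟨O, η, hO, h0, hη, hη0, ?_, ?_⟩
  · intro z hz t
    have := congrArg (fun h => h t) (hsol z hz)
    simp only [Φ, ContinuousMap.sub_apply, ContinuousMap.zero_apply, sub_sub, sub_eq_zero] at this
    exact this
  · intro z hz w t
    have hηd : HasFDerivAt η (fderiv ℝ η z) z :=
      ((hη.contDiffAt (hO.mem_nhds hz)).differentiableAt (by simp)).hasFDerivAt
    have h1 : HasFDerivAt (fun z => Φ (z, η z)) _ z :=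
      (hΦ.differentiable (by simp) (z, η z)).hasFDerivAt.comp z ((hasFDerivAt_id z).prodMk hηd)
    have h2 : (fun z => Φ (z, η z)) =ᶠ[𝓝 z] fun _ => 0 := by
      filter_upwards [hO.mem_nhds hz] with x hx using hsol x hx
    have h3 := h1.unique ((hasFDerivAt_const 0 z).congr_of_eventuallyEq h2)
    have h4 := congrArg (fun h => h w) h3
    simp only [ContinuousLinearMap.comp_apply, ContinuousLinearMap.prod_apply, hΦd,
      ContinuousLinearMap.id_apply, zero_apply] at h4
    have h5 := congrArg (fun h => h t) h4
    simp only [ContinuousMap.sub_apply, ContinuousMap.zero_apply, sub_sub, sub_eq_zero] at h5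
    refine h5.trans ?_
    simp only [ContinuousMap.add_apply, primitiveL_apply]
    refine congrArg (fun h : ℝ → E₂ => w.2 + ∫ s in (1 : ℝ)..t, h s) ?_
    ext s
    exact fderiv_eval_clm hA _ _

theorem hasDerivAt_integral_IccExtend {F : Type*} [NormedAddCommGroup F] [NormedSpace ℝ F]
    [CompleteSpace F] {h : Icc (0 : ℝ) 1 → F} (hh : Continuous h) (c : F) (t : Icc (0 : ℝ) 1) :
    HasDerivAt (fun t : ℝ => c + ∫ s in (1 : ℝ)..t, IccExtend zero_le_one h s) (h t) (t : ℝ) := by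
  have hc : Continuous (IccExtend (zero_le_one (α := ℝ)) h) := hh.Icc_extend'
  have := (intervalIntegral.integral_hasDerivAt_right (hc.intervalIntegrable 1 (t : ℝ))
    hc.stronglyMeasurable.stronglyMeasurableAtFilter hc.continuousAt).const_add c
  simpa using this

omit [CompleteSpace E₁] in
-- Moving the endpoint along the graph should move the path inside its leaf, that is by t A(tx, η)a
-- at time t. The defect W(t) = ν(t) - t A(tx, η)a satisfies a linear equation W' = L(t)W, thanks to
-- the integrability condition, and W(1) = 0. Uniqueness, run backwards from t = 1, gives W = 0, and
-- W(0) = ν(0).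
theorem leaf_variation_eq_zero {A : E₁ × E₂ → E₁ →L[ℝ] E₂} (hA : ContDiff ℝ ∞ A)
    (x a : E₁) (y : E₂) (η ν : C(Icc (0 : ℝ) 1, E₂))
    (hη : ∀ t, η t = y + ∫ s in (1 : ℝ)..t,
        IccExtend zero_le_one (fun s : Icc (0 : ℝ) 1 => A ((s : ℝ) • x, η s) x) s)
    (hν : ∀ t, ν t = A (x, y) a + ∫ s in (1 : ℝ)..t,
        IccExtend zero_le_one (fun s : Icc (0 : ℝ) 1 =>
          fderiv ℝ A ((s : ℝ) • x, η s) ((s : ℝ) • a, ν s) x + A ((s : ℝ) • x, η s) a) s)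
    (hint : ∀ t : Icc (0 : ℝ) 1, ∀ b,
      fderiv ℝ A ((t : ℝ) • x, η t) (x, A ((t : ℝ) • x, η t) x) b =
        fderiv ℝ A ((t : ℝ) • x, η t) (b, A ((t : ℝ) • x, η t) b) x) :
    ν ⟨0, by simp⟩ = 0 := by
  have hAc := hA.continuous
  have hA'c := hA.continuous_fderiv (by simp)
  -- η and ν live on [0,1]; their integral formulas make sense on ℝ and have two-sided derivatives
  -- at the endpoints as well.
  set e : ℝ → E₂ := fun t => y + ∫ s in (1 : ℝ)..t,
        IccExtend zero_le_one (fun s : Icc (0 : ℝ) 1 => A ((s : ℝ) • x, η s) x) s with he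
  set f : ℝ → E₂ := fun t => A (x, y) a + ∫ s in (1 : ℝ)..t,
        IccExtend zero_le_one (fun s : Icc (0 : ℝ) 1 =>
          fderiv ℝ A ((s : ℝ) • x, η s) ((s : ℝ) • a, ν s) x + A ((s : ℝ) • x, η s) a) s with hf
  have hed : ∀ t : Icc (0 : ℝ) 1, HasDerivAt e (A ((t : ℝ) • x, η t) x) t := fun t =>
    hasDerivAt_integral_IccExtend (by fun_prop) y t
  have hfd : ∀ t : Icc (0 : ℝ) 1, HasDerivAt f (fderiv ℝ A ((t : ℝ) • x, η t)
      ((t : ℝ) • a, ν t) x + A ((t : ℝ) • x, η t) a) t := fun t =>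
    hasDerivAt_integral_IccExtend (by fun_prop) _ t
  let W : ℝ → E₂ := fun t => f t - t • A (t • x, e t) a
  let Lc : C(Icc (0 : ℝ) 1, E₂ →L[ℝ] E₂) := ⟨fun t =>
    ((fderiv ℝ A ((t : ℝ) • x, η t)).comp (ContinuousLinearMap.inr ℝ E₁ E₂)).flip x, by
      have h1 : Continuous fun t : Icc (0 : ℝ) 1 =>
          (fderiv ℝ A ((t : ℝ) • x, η t)).comp (ContinuousLinearMap.inr ℝ E₁ E₂) := by fun_prop
      exact ((ContinuousLinearMap.flipₗᵢ ℝ E₂ E₁ E₂).continuous.comp h1).clm_apply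
        continuous_const⟩
  have hWd : ∀ t : Icc (0 : ℝ) 1, HasDerivAt W (Lc t (W t)) t := by
    intro t
    have h1 : HasDerivAt (fun s : ℝ => ((s • x, e s) : E₁ × E₂)) (x, A ((t : ℝ) • x, η t) x) t := by
      have := ((hasDerivAt_id (t : ℝ)).smul_const x).prodMk (hed t)
      simpa using this
    have h2 : HasDerivAt (fun s : ℝ => A (s • x, e s))
        (fderiv ℝ A ((t : ℝ) • x, η t) (x, A ((t : ℝ) • x, η t) x)) t := by
      have := (hA.differentiable (by simp) ((t : ℝ) • x, e t)).hasFDerivAt.comp_hasDerivAt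
        (t : ℝ) h1
      rwa [show e t = η t from (hη t).symm] at this
    have h3 := (hfd t).sub ((hasDerivAt_id (t : ℝ)).smul (h2.clm_apply (hasDerivAt_const _ a)))
    refine h3.congr_deriv ?_
    have h4 : W t = ν t - (t : ℝ) • A ((t : ℝ) • x, η t) a := by
      simp only [W]
      rw [show e t = η t from (hη t).symm, show f t = ν t from (hν t).symm]
    -- Splitting the direction into a part tangent to the graph and the defect lets `hint` cancel
    -- everything but the term in W.
    have h5 : ((t : ℝ) • a, ν t) = (t : ℝ) • ((a, A ((t : ℝ) • x, η t) a) : E₁ × E₂)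
        + (0, W t) := by
      rw [h4]; ext <;> simp
    rw [h5, map_add, map_smul]
    simp only [Lc, id, one_smul, map_zero, add_zero, add_apply, smul_apply, hint t a]
    rw [show e t = η t from (hη t).symm]
    abel
  have hc : ContinuousOn W (Icc 0 1) := fun t ht => (hWd ⟨t, ht⟩).continuousAt.continuousWithinAt
  have h0 : EqOn W (fun _ => 0) (Icc 0 1) := by
    refine ODE_solution_unique_of_mem_Icc_left
      (v := fun t w => Lc (projIcc 0 1 zero_le_one t) w) (K := ‖Lc‖₊) (s := fun _ => univ)
      ?_ hc ?_ (fun _ _ => mem_univ _) continuousOn_const ?_ (fun _ _ => mem_univ _) ?_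
    · intro t _
      refine ((Lc _).lipschitz.weaken ?_).lipschitzOnWith
      exact Lc.norm_coe_le_norm _
    · intro t ht
      have := (hWd ⟨t, ht.1.le, ht.2⟩).hasDerivWithinAt (s := Iic t)
      simp only [projIcc_of_mem zero_le_one ⟨ht.1.le, ht.2⟩]
      exact this
    · intro t _
      simpa using hasDerivWithinAt_const t (Iic t) (0 : E₂)
    · simp [W, f, e]
  have := h0 (left_mem_Icc.2 zero_le_one)
  simp only [W, zero_smul, sub_zero] at this
  exact (hν ⟨0, by simp⟩).trans this

/-- **Frobenius theorem** for a distribution given as a graph: if `A` satisfies the integrability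
condition, there is a submersion which is constant along the graph of `A`. -/
theorem exists_submersion_of_integrable_graph {A : E₁ × E₂ → E₁ →L[ℝ] E₂} (hA : ContDiff ℝ ∞ A)
    (hint : ∀ᶠ z in 𝓝 (0 : E₁ × E₂), ∀ a b,
      fderiv ℝ A z (a, A z a) b = fderiv ℝ A z (b, A z b) a) :
    ∃ (O : Set (E₁ × E₂)) (g : E₁ × E₂ → E₂), IsOpen O ∧ 0 ∈ O ∧ ContDiffOn ℝ ∞ g O ∧ g 0 = 0 ∧
      (∀ z ∈ O, ∀ a, fderiv ℝ g z (a, A z a) = 0) ∧ ∀ v, fderiv ℝ g 0 (0, v) = v := by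
  obtain ⟨O, η, hO, h0, hη, hη0, hsol, hvar⟩ := exists_leaf_path hA
  obtain ⟨r, hr, hball⟩ := Metric.eventually_nhds_iff_ball.1 hint
  have hc : ContinuousOn (fun z => rayL E₁ E₂ (z, η z)) O :=
    (rayL E₁ E₂).continuous.comp_continuousOn (continuousOn_id.prodMk hη.continuousOn)
  let ev : C(Icc (0 : ℝ) 1, E₂) →L[ℝ] E₂ := ContinuousMap.evalCLM ℝ ⟨0, by simp⟩
  have hd : ∀ z ∈ O, ∀ w, fderiv ℝ (fun z => η z ⟨0, by simp⟩) z w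
      = fderiv ℝ η z w ⟨0, by simp⟩ := by
    intro z hz w
    have hηd : HasFDerivAt η (fderiv ℝ η z) z :=
      ((hη.contDiffAt (hO.mem_nhds hz)).differentiableAt (by simp)).hasFDerivAt
    have : HasFDerivAt (fun z => η z ⟨0, by simp⟩) (ev.comp (fderiv ℝ η z)) z :=
      ev.hasFDerivAt.comp z hηd
    rw [this.fderiv]
    rfl
  -- The integrability condition holds only near 0, so the domain is restricted to those z whose
  -- whole path stays in that ball.
  refine ⟨O ∩ (fun z => rayL E₁ E₂ (z, η z)) ⁻¹' Metric.ball 0 r, fun z => η z ⟨0, by simp⟩,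
    hc.isOpen_inter_preimage hO Metric.isOpen_ball, ⟨h0, ?_⟩, ?_, ?_, ?_, ?_⟩
  · simp only [mem_preimage, hη0]
    rw [show (0 : E₁ × E₂) = 0 from rfl, ← Prod.zero_eq_mk, map_zero]
    exact Metric.mem_ball_self hr
  · exact ev.contDiff.comp_contDiffOn (hη.mono inter_subset_left)
  · simp [hη0]
  · rintro z ⟨hz, hzr⟩ a
    rw [hd z hz]
    refine leaf_variation_eq_zero hA z.1 a z.2 (η z) _ (hsol z hz) (hvar z hz (a, A z a)) ?_
    intro t b
    refine hball _ ?_ _ _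
    rw [mem_preimage, mem_ball_zero_iff] at hzr
    rw [mem_ball_zero_iff]
    exact ((norm_fst_le _).trans ((rayL E₁ E₂ (z, η z)).norm_coe_le_norm t)).trans_lt hzr
  · intro v
    rw [hd 0 h0, hvar 0 h0]
    simp [IccExtend]

end Leaf

/-! ### First integrals of involutive distributions of constant rank. -/

section FirstIntegrals

/-- Cut-off by a bump function. It turns the locally defined slope map of a distribution into the
globally smooth one required by the graph form of Frobenius. -/
theorem exists_contDiff_eventuallyEq {V F : Type*} [NormedAddCommGroup V] [NormedSpace ℝ V]
    [FiniteDimensional ℝ V] [NormedAddCommGroup F] [NormedSpace ℝ F] {R : Set V} (hR : IsOpen R)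
    {f : V → F} (hf : ContDiffOn ℝ ∞ f R) {x : V} (hx : x ∈ R) :
    ∃ g : V → F, ContDiff ℝ ∞ g ∧ g =ᶠ[𝓝 x] f := by
  obtain ⟨r, hr, hrR⟩ := Metric.isOpen_iff.1 hR x hx
  let χ : ContDiffBump x := ⟨r / 4, r / 2, by positivity, by linarith⟩
  refine ⟨fun y => χ y • f y, ?_, ?_⟩
  · rw [contDiff_iff_contDiffAt]
    intro y
    by_cases hy : y ∈ R
    · exact χ.contDiffAt.smul (hf.contDiffAt (hR.mem_nhds hy))
    · have hy' : y ∉ tsupport χ := by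
        rw [χ.tsupport_eq]
        intro h
        exact hy (hrR (Metric.closedBall_subset_ball (by simp [χ]; linarith) h))
      refine (contDiffAt_const (c := (0 : F))).congr_of_eventuallyEq ?_
      filter_upwards [notMem_tsupport_iff_eventuallyEq.1 hy'] with w hw
      rw [hw]; simp
  · filter_upwards [χ.eventuallyEq_one] with y hy
    rw [hy]; simp

variable {ι : Type*} [Fintype ι] {E₁ E₂ : Type u}
  [NormedAddCommGroup E₁] [NormedSpace ℝ E₁] [NormedAddCommGroup E₂] [NormedSpace ℝ E₂]

/-- Fields tangent to the graph of `A` with tangent bracket: the curvature form of the graph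
vanishes on them. -/
theorem graph_curvature_eq_zero {A : E₁ × E₂ → E₁ →L[ℝ] E₂} {X Y : E₁ × E₂ → E₁ × E₂}
    {q : E₁ × E₂} (hA : DifferentiableAt ℝ A q) (hX : DifferentiableAt ℝ X q)
    (hY : DifferentiableAt ℝ Y q) (hAX : ∀ᶠ z in 𝓝 q, (X z).2 = A z (X z).1)
    (hAY : ∀ᶠ z in 𝓝 q, (Y z).2 = A z (Y z).1)
    (hXY : (VectorField.lieBracket ℝ X Y q).2 = A q (VectorField.lieBracket ℝ X Y q).1) :
    fderiv ℝ A q (X q) (Y q).1 = fderiv ℝ A q (Y q) (X q).1 := by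
  -- Differentiating X₂ = A X₁ expresses the vertical part of DX; in the bracket the terms A(DX₁)
  -- match its slope, leaving only the antisymmetrised derivative of A.
  have key : ∀ {X : E₁ × E₂ → E₁ × E₂}, DifferentiableAt ℝ X q →
      (∀ᶠ z in 𝓝 q, (X z).2 = A z (X z).1) → ∀ w,
      (fderiv ℝ X q w).2 = A q (fderiv ℝ X q w).1 + fderiv ℝ A q w (X q).1 := by
    intro X hX hAX w
    have h1 : HasFDerivAt (fun z => A z (X z).1) _ q :=
      hA.hasFDerivAt.clm_apply (hasFDerivAt_fst.comp q hX.hasFDerivAt)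
    have h2 : HasFDerivAt (fun z => (X z).2) _ q := hasFDerivAt_snd.comp q hX.hasFDerivAt
    have := DFunLike.congr_fun (h2.unique (h1.congr_of_eventuallyEq hAX)) w
    simpa using this
  simp only [VectorField.lieBracket, Prod.snd_sub, Prod.fst_sub, map_sub, key hX hAX,
    key hY hAY] at hXY
  rw [add_sub_add_comm, add_eq_left, sub_eq_zero] at hXY
  exact hXY

variable [FiniteDimensional ℝ E₁] [FiniteDimensional ℝ E₂]

/-- Where the E₁-components T of the frame are invertible, the distribution is the graph of A₀ = B
T⁻¹, with B the E₂-components. Involutivity of the frame is the integrability condition for A₀. -/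
theorem exists_submersion_of_involutive_prod {N : Set (E₁ × E₂)} (hN : IsOpen N) (h0 : 0 ∈ N)
    {Z : ι → E₁ × E₂ → E₁ × E₂} (hZ : ∀ i, ContDiffOn ℝ ∞ (Z i) N)
    (hbij : Function.Bijective fun t : ι → ℝ => ∑ i, t i • (Z i 0).1)
    (hinv : ∀ i j, ∀ z ∈ N, VectorField.lieBracket ℝ (Z i) (Z j) z ∈
      Submodule.span ℝ (range fun l => Z l z)) :
    ∃ (O : Set (E₁ × E₂)) (g : E₁ × E₂ → E₂), IsOpen O ∧ 0 ∈ O ∧ O ⊆ N ∧ ContDiffOn ℝ ∞ g O ∧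
      g 0 = 0 ∧ (∀ z ∈ O, ∀ i, fderiv ℝ g z (Z i z) = 0) ∧
      ∀ w, fderiv ℝ g 0 w = 0 → w ∈ Submodule.span ℝ (range fun l => Z l 0) := by
  have : CompleteSpace E₁ := FiniteDimensional.complete ℝ E₁
  have : CompleteSpace E₂ := FiniteDimensional.complete ℝ E₂
  let T : E₁ × E₂ → (ι → ℝ) →L[ℝ] E₁ := fun q =>
    ∑ i, (ContinuousLinearMap.proj (R := ℝ) (φ := fun _ : ι => ℝ) i).smulRight (Z i q).1
  let B : E₁ × E₂ → (ι → ℝ) →L[ℝ] E₂ := fun q =>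
    ∑ i, (ContinuousLinearMap.proj (R := ℝ) (φ := fun _ : ι => ℝ) i).smulRight (Z i q).2
  have hTa : ∀ q t, T q t = ∑ i, t i • (Z i q).1 := fun q t => by simp [T]
  have hBa : ∀ q t, B q t = ∑ i, t i • (Z i q).2 := fun q t => by simp [B]
  have hT : ContDiffOn ℝ ∞ T N := ContDiffOn.sum fun i _ =>
    (ContinuousLinearMap.smulRightL ℝ (ι → ℝ) E₁ (ContinuousLinearMap.proj i)).contDiff.comp_contDiffOn
      (contDiff_fst.comp_contDiffOn (hZ i))
  have hB : ContDiffOn ℝ ∞ B N := ContDiffOn.sum fun i _ =>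
    (ContinuousLinearMap.smulRightL ℝ (ι → ℝ) E₂ (ContinuousLinearMap.proj i)).contDiff.comp_contDiffOn
      (contDiff_snd.comp_contDiffOn (hZ i))
  let R : Set (E₁ × E₂) :=
    N ∩ T ⁻¹' range ((↑) : ((ι → ℝ) ≃L[ℝ] E₁) → ((ι → ℝ) →L[ℝ] E₁))
  have hR : IsOpen R := hT.continuousOn.isOpen_inter_preimage hN ContinuousLinearEquiv.isOpen
  have h0R : 0 ∈ R := by
    refine ⟨h0, (LinearEquiv.ofBijective (T 0).toLinearMap ?_).toContinuousLinearEquiv, ?_⟩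
    · convert hbij using 1
      ext t; exact hTa 0 t
    · ext t; rfl
  let A₀ : E₁ × E₂ → E₁ →L[ℝ] E₂ := fun q => (B q).comp (T q).inverse
  have hA₀ : ContDiffOn ℝ ∞ A₀ R := by
    refine (hB.mono inter_subset_left).clm_comp ?_
    rintro q ⟨hq, e, he⟩
    have h1 : ContDiffAt ℝ ∞ ContinuousLinearMap.inverse (T q) := he ▸ contDiffAt_map_inverse e
    exact h1.comp_contDiffWithinAt q ((hT q hq).mono inter_subset_left)
  have hA₀Z : ∀ q ∈ R, ∀ i, (Z i q).2 = A₀ q (Z i q).1 := by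
    classical
    rintro q ⟨hq, e, he⟩ i
    have h1 : (Z i q).1 = e (Pi.single i 1) := by
      rw [show e (Pi.single i 1) = (e : (ι → ℝ) →L[ℝ] E₁) (Pi.single i 1) from rfl, he, hTa]
      simp [Pi.single_apply]
    have h2 : (Z i q).2 = B q (Pi.single i 1) := by
      rw [hBa]
      simp [Pi.single_apply]
    simp only [A₀, ← he, ContinuousLinearMap.inverse_equiv, ContinuousLinearMap.comp_apply]
    rw [h1, h2]
    simp
  have hA₀s : ∀ q ∈ R, ∀ a, (a, A₀ q a) ∈ Submodule.span ℝ (range fun l => Z l q) := by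
    rintro q ⟨hq, e, he⟩ a
    have h1 : ((a, A₀ q a) : E₁ × E₂) = ∑ i, (e.symm a) i • Z i q := by
      refine Prod.ext ?_ ?_
      · rw [Prod.fst_sum]
        simp only [Prod.smul_fst]
        rw [← hTa, ← he]
        simp
      · rw [Prod.snd_sum]
        simp only [Prod.smul_snd]
        rw [← hBa]
        simp [A₀, ← he]
    rw [h1]
    exact Submodule.sum_mem _ fun i _ => Submodule.smul_mem _ _ (Submodule.subset_span ⟨i, rfl⟩)
  have hA₀m : ∀ q ∈ R, ∀ w ∈ Submodule.span ℝ (range fun l => Z l q), w.2 = A₀ q w.1 := by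
    intro q hq w hw
    induction hw using Submodule.span_induction with
    | mem x hx => obtain ⟨i, rfl⟩ := hx; exact hA₀Z q hq i
    | zero => simp
    | add x y _ _ hx hy => simp [hx, hy]
    | smul c x _ hx => simp [hx]
  -- Both sides are bilinear in (v, w), so it is enough to check the frame, where
  -- `graph_curvature_eq_zero` applies.
  have hint : ∀ q ∈ R, ∀ v ∈ Submodule.span ℝ (range fun l => Z l q),
      ∀ w ∈ Submodule.span ℝ (range fun l => Z l q),
      fderiv ℝ A₀ q v w.1 = fderiv ℝ A₀ q w v.1 := by
    intro q hq v hv w hw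
    induction hv, hw using Submodule.span_induction₂ with
    | mem_mem x y hx hy =>
      obtain ⟨i, rfl⟩ := hx
      obtain ⟨j, rfl⟩ := hy
      have hd : ∀ i, DifferentiableAt ℝ (Z i) q := fun i =>
        ((hZ i).contDiffAt (hN.mem_nhds hq.1)).differentiableAt (by simp)
      have he : ∀ i, ∀ᶠ z in 𝓝 q, (Z i z).2 = A₀ z (Z i z).1 := fun i => by
        filter_upwards [hR.mem_nhds hq] with z hz using hA₀Z z hz i
      exact graph_curvature_eq_zero
        ((hA₀.contDiffAt (hR.mem_nhds hq)).differentiableAt (by simp)) (hd i) (hd j) (he i) (he j)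
        (hA₀m q hq _ (hinv i j q hq.1))
    | zero_left => simp
    | zero_right => simp
    | add_left _ _ _ _ _ _ h1 h2 => simp [h1, h2]
    | add_right _ _ _ _ _ _ h1 h2 => simp [h1, h2]
    | smul_left _ _ _ _ _ h => simp [h]
    | smul_right _ _ _ _ _ h => simp [h]
  obtain ⟨A, hA, hAA⟩ := exists_contDiff_eventuallyEq hR hA₀ h0R
  obtain ⟨O, g, hO, h0O, hg, hg0, hgA, hg1⟩ := exists_submersion_of_integrable_graph hA (by
    filter_upwards [hAA.eventually_nhds, hR.mem_nhds h0R] with q hq hqR a b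
    have hq' : A =ᶠ[𝓝 q] A₀ := hq
    rw [hq'.fderiv_eq, hq'.self_of_nhds]
    exact hint q hqR _ (hA₀s q hqR a) _ (hA₀s q hqR b))
  obtain ⟨O', hO'A, hO', h0O'⟩ := eventually_nhds_iff.1 hAA
  refine ⟨O ∩ O' ∩ R, g, (hO.inter hO').inter hR, ⟨⟨h0O, h0O'⟩, h0R⟩,
    fun z hz => hz.2.1, hg.mono fun z hz => hz.1.1, hg0, ?_, ?_⟩
  · rintro z ⟨⟨hzO, hzO'⟩, hzR⟩ i
    have := hgA z hzO (Z i z).1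
    rwa [hO'A z hzO', ← hA₀Z z hzR i] at this
  · intro w hw
    -- The graph part is killed by dg and the remaining E₂-part is reproduced by it, so the kernel
    -- of dg at 0 is exactly the graph.
    have h1 : w = (w.1, A 0 w.1) + (0, w.2 - A 0 w.1) := by ext <;> simp
    rw [h1, map_add, hgA 0 h0O, hg1, zero_add, sub_eq_zero, hO'A 0 h0O'] at hw
    have := hA₀s 0 h0R w.1
    rwa [← hw] at this

/-- **Frobenius theorem**: a vector outside an involutive distribution of constant rank is detected
by a first integral of the distribution. -/
theorem exists_firstIntegral {V : Type u} [NormedAddCommGroup V] [NormedSpace ℝ V]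
    [FiniteDimensional ℝ V] {N : Set V} (hN : IsOpen N) {z₀ : V} (h0 : z₀ ∈ N)
    {Z : ι → V → V} (hZ : ∀ i, ContDiffOn ℝ ∞ (Z i) N)
    (hli : LinearIndependent ℝ fun i => Z i z₀)
    (hinv : ∀ i j, ∀ z ∈ N, VectorField.lieBracket ℝ (Z i) (Z j) z ∈
      Submodule.span ℝ (range fun l => Z l z))
    {ξ : V} (hξ : ξ ∉ Submodule.span ℝ (range fun l => Z l z₀)) :
    ∃ (O : Set V) (g : V → ℝ), IsOpen O ∧ z₀ ∈ O ∧ O ⊆ N ∧ ContDiffOn ℝ ∞ g O ∧ g z₀ = 0 ∧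
      (∀ z ∈ O, ∀ i, fderiv ℝ g z (Z i z) = 0) ∧ fderiv ℝ g z₀ ξ ≠ 0 := by
  set D := Submodule.span ℝ (range fun l => Z l z₀) with hD
  -- The distribution at z₀ and a complement serve as E₁ and E₂, after the affine change of
  -- coordinates τ; this makes the E₁-components of the frame a basis at the origin.
  obtain ⟨W, hW⟩ := D.exists_isCompl
  let c : (D × W) ≃L[ℝ] V := (Submodule.prodEquivOfIsCompl D W hW).toContinuousLinearEquiv
  have hcs : ∀ i, (c.symm (Z i z₀)).1 = ⟨Z i z₀, Submodule.subset_span ⟨i, rfl⟩⟩ := by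
    intro i
    have : Z i z₀ = c (⟨Z i z₀, Submodule.subset_span ⟨i, rfl⟩⟩, 0) := by
      simp [c, Submodule.coe_prodEquivOfIsCompl']
    conv_lhs => rw [this]
    simp
  let τ : D × W → V := fun q => z₀ + c q
  have hτ : ContDiff ℝ ∞ τ := contDiff_const.add c.contDiff
  have hτd : ∀ q, HasFDerivAt τ (c : D × W →L[ℝ] V) q := fun q => c.hasFDerivAt.const_add z₀
  have hτ0 : τ 0 = z₀ := by simp [τ]
  let Z' : ι → D × W → D × W := fun i q => c.symm (Z i (τ q))
  have hspan : ∀ q, Submodule.span ℝ (range fun l => Z' l q) =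
      (Submodule.span ℝ (range fun l => Z l (τ q))).map c.symm.toLinearMap := by
    intro q
    rw [Submodule.map_span, ← range_comp]
    rfl
  have hZ'd : ∀ i, ∀ q ∈ τ ⁻¹' N, ∀ w, fderiv ℝ (Z' i) q w = c.symm (fderiv ℝ (Z i) (τ q) (c w)) := by
    intro i q hq w
    have h1 : HasFDerivAt (Z i) (fderiv ℝ (Z i) (τ q)) (τ q) :=
      (((hZ i).contDiffAt (hN.mem_nhds hq)).differentiableAt (by simp)).hasFDerivAt
    have h2 : HasFDerivAt (Z' i) _ q := c.symm.hasFDerivAt.comp q (h1.comp q (hτd q))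
    rw [h2.fderiv]
    rfl
  obtain ⟨O, g, hO, h0O, hON, hg, hg0, hgZ, hgk⟩ := exists_submersion_of_involutive_prod
    (hN.preimage hτ.continuous) (by simpa [hτ0] using h0) (Z := Z')
    (fun i => c.symm.contDiff.comp_contDiffOn ((hZ i).comp hτ.contDiffOn fun q hq => hq))
    (by
      simp only [Z', hτ0, hcs]
      let b := Module.Basis.span hli
      have : (fun t : ι → ℝ => ∑ i, t i • (⟨Z i z₀, Submodule.subset_span ⟨i, rfl⟩⟩ : D)) =
          b.equivFun.symm := by
        ext t
        simp [b, Module.Basis.equivFun_symm_apply, Module.Basis.span_apply]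
      rw [this]
      exact b.equivFun.symm.bijective)
    (by
      intro i j q hq
      rw [hspan]
      refine ⟨_, hinv i j (τ q) hq, ?_⟩
      simp only [VectorField.lieBracket, hZ'd _ q hq]
      simp [Z'])
  have hgk' : fderiv ℝ g 0 (c.symm ξ) ≠ 0 := by
    intro h
    have := hgk _ h
    rw [hspan, hτ0] at this
    obtain ⟨x, hx, hxξ⟩ := this
    exact hξ (by rw [← c.symm.injective hxξ]; exact hx)
  -- The submersion has values in W; a functional nonzero on the image of ξ makes it a scalar first
  -- integral.
  obtain ⟨ℓ, hℓ⟩ : ∃ ℓ : W →L[ℝ] ℝ, ℓ (fderiv ℝ g 0 (c.symm ξ)) ≠ 0 := by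
    obtain ⟨ℓ, -, h⟩ := exists_dual_vector ℝ _ (norm_ne_zero_iff.2 hgk')
    refine ⟨ℓ, ?_⟩
    rw [h]
    simpa using hgk'
  let σ : V → D × W := fun z => c.symm (z - z₀)
  have hσ : ContDiff ℝ ∞ σ := c.symm.contDiff.comp (contDiff_id.sub contDiff_const)
  have hσd : ∀ z, HasFDerivAt σ (c.symm : V →L[ℝ] D × W) z := fun z =>
    c.symm.hasFDerivAt.comp z ((hasFDerivAt_id z).sub_const z₀)
  have hτσ : ∀ z, τ (σ z) = z := fun z => by simp [τ, σ]
  have hσ0 : σ z₀ = 0 := by simp [σ]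
  have hd : ∀ z ∈ σ ⁻¹' O, ∀ w, fderiv ℝ (fun z => ℓ (g (σ z))) z w =
      ℓ (fderiv ℝ g (σ z) (c.symm w)) := by
    intro z hz w
    have h1 : HasFDerivAt g (fderiv ℝ g (σ z)) (σ z) :=
      ((hg.contDiffAt (hO.mem_nhds hz)).differentiableAt (by simp)).hasFDerivAt
    have h2 : HasFDerivAt (fun z => ℓ (g (σ z))) _ z :=
      ℓ.hasFDerivAt.comp z (h1.comp z (hσd z))
    rw [h2.fderiv]
    rfl
  have hz0 : z₀ ∈ σ ⁻¹' O := by simpa [hσ0] using h0O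
  refine ⟨σ ⁻¹' O, fun z => ℓ (g (σ z)), hO.preimage hσ.continuous, hz0, ?_, ?_, ?_, ?_, ?_⟩
  · intro z hz
    have := hON hz
    rwa [mem_preimage, hτσ] at this
  · exact ℓ.contDiff.comp_contDiffOn (hg.comp hσ.contDiffOn fun z hz => hz)
  · simp [hσ0, hg0]
  · intro z hz i
    rw [hd z hz]
    have := hgZ _ hz i
    simp only [Z', hτσ] at this
    rw [this, map_zero]
  · rw [hd z₀ hz0, hσ0]
    exact hℓ

end FirstIntegrals

namespace SprayGeometry

/-! ### Vector fields on TM in bundle charts. -/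

section Coordinates

variable {n : ℕ} {M : Type*} [TopologicalSpace M] [ChartedSpace (EuclideanSpace ℝ (Fin n)) M]
  [IsManifold (𝓡 n) ∞ M]

/-- The model of `TM`, with points `(x, y)`. -/
abbrev Coord (n : ℕ) : Type := EuclideanSpace ℝ (Fin n) × EuclideanSpace ℝ (Fin n)

/-- The coordinates `(x, y)` on `TM` induced by the preferred chart of `M` at the base point
of `u`. -/
abbrev crd (u : TanB n M) : PartialEquiv (TanB n M) (Coord n) :=
  extChartAt (𝓡 n).tangent u

/-- The differential of the coordinates at `w`. -/
def dcrd (u w : TanB n M) : TangentSpace (𝓡 n).tangent w →L[ℝ] Coord n :=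
  mfderiv (𝓡 n).tangent 𝓘(ℝ, Coord n) (crd u) w

/-- The coordinate expression of a vector field. -/
def rep (u : TanB n M) (X : VF n M) : Coord n → Coord n :=
  fun z => dcrd u ((crd u).symm z) (X ((crd u).symm z))

/-- The vector field with a given coordinate expression. -/
def ofRep (u : TanB n M) (Y : Coord n → Coord n) : VF n M :=
  fun w => (dcrd u w).inverse (Y (crd u w))

theorem minSmoothness_two_le_infty : minSmoothness ℝ 2 ≤ (∞ : ℕ∞ω) := by
  rw [minSmoothness_of_isRCLikeNormedField]
  exact WithTop.coe_le_coe.2 (le_top (a := (2 : ℕ∞)))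

theorem isOpen_target (u : TanB n M) : IsOpen (crd u).target := isOpen_extChartAt_target u

theorem isOpen_source (u : TanB n M) : IsOpen (crd u).source := isOpen_extChartAt_source u

theorem mem_source_iff (u w : TanB n M) :
    w ∈ (crd u).source ↔ w.1 ∈ (extChartAt (𝓡 n) u.1).source := by
  rw [extChartAt_source, extChartAt_source, TangentBundle.mem_chart_source_iff]

theorem contMDiffAt_crd {u w : TanB n M} (hw : w ∈ (crd u).source) :
    ContMDiffAt (𝓡 n).tangent 𝓘(ℝ, Coord n) ∞ (crd u) w :=
  contMDiffAt_extChartAt' (by rwa [← extChartAt_source (𝓡 n).tangent])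

theorem contMDiffAt_crd_symm {u : TanB n M} {z : Coord n} (hz : z ∈ (crd u).target) :
    ContMDiffAt 𝓘(ℝ, Coord n) (𝓡 n).tangent ∞ (crd u).symm z :=
  (contMDiffOn_extChartAt_symm u).contMDiffAt ((isOpen_target u).mem_nhds hz)

theorem isInvertible_dcrd {u w : TanB n M} (hw : w ∈ (crd u).source) :
    (dcrd u w).IsInvertible :=
  isInvertible_mfderiv_extChartAt hw

theorem dcrd_comp_mfderiv_symm {u : TanB n M} {z : Coord n} (hz : z ∈ (crd u).target) :
    (dcrd u ((crd u).symm z)).comp (mfderiv 𝓘(ℝ, Coord n) (𝓡 n).tangent (crd u).symm z) =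
      ContinuousLinearMap.id ℝ _ := by
  have := mfderiv_extChartAt_comp_mfderivWithin_extChartAt_symm (I := (𝓡 n).tangent) hz
  rwa [ModelWithCorners.range_eq_univ, mfderivWithin_univ] at this

theorem mfderiv_symm_comp_dcrd {u : TanB n M} {z : Coord n} (hz : z ∈ (crd u).target) :
    (mfderiv 𝓘(ℝ, Coord n) (𝓡 n).tangent (crd u).symm z).comp (dcrd u ((crd u).symm z)) =
      ContinuousLinearMap.id ℝ _ := by
  have := mfderivWithin_extChartAt_symm_comp_mfderiv_extChartAt (I := (𝓡 n).tangent) hz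
  rwa [ModelWithCorners.range_eq_univ, mfderivWithin_univ] at this

theorem inverse_mfderiv_symm {u : TanB n M} {z : Coord n} (hz : z ∈ (crd u).target) :
    (mfderiv 𝓘(ℝ, Coord n) (𝓡 n).tangent (crd u).symm z).inverse = dcrd u ((crd u).symm z) :=
  ContinuousLinearMap.inverse_eq (mfderiv_symm_comp_dcrd hz) (dcrd_comp_mfderiv_symm hz)

theorem isInvertible_mfderiv_symm {u : TanB n M} {z : Coord n} (hz : z ∈ (crd u).target) :
    (mfderiv 𝓘(ℝ, Coord n) (𝓡 n).tangent (crd u).symm z).IsInvertible :=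
  ContinuousLinearMap.IsInvertible.of_inverse (mfderiv_symm_comp_dcrd hz)
    (dcrd_comp_mfderiv_symm hz)

theorem mpullback_symm_eq_rep {u : TanB n M} {z : Coord n} (hz : z ∈ (crd u).target)
    (X : VF n M) :
    VectorField.mpullback 𝓘(ℝ, Coord n) (𝓡 n).tangent (crd u).symm X z = rep u X z := by
  rw [VectorField.mpullback_apply, inverse_mfderiv_symm hz]
  rfl

theorem mpullback_symm_eventuallyEq_rep {u : TanB n M} {z : Coord n} (hz : z ∈ (crd u).target)
    (X : VF n M) :
    VectorField.mpullback 𝓘(ℝ, Coord n) (𝓡 n).tangent (crd u).symm X =ᶠ[𝓝 z] rep u X := by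
  filter_upwards [(isOpen_target u).mem_nhds hz] with y hy using mpullback_symm_eq_rep hy X

theorem rep_ofRep {u : TanB n M} {z : Coord n} (hz : z ∈ (crd u).target)
    (Y : Coord n → Coord n) : rep u (ofRep u Y) z = Y z := by
  have h := (isInvertible_dcrd ((crd u).map_target hz))
  simp only [rep, ofRep, (crd u).right_inv hz]
  exact h.self_apply_inverse _

theorem contDiffAt_rep {u : TanB n M} {z : Coord n} (hz : z ∈ (crd u).target) {X : VF n M}
    (hX : SmoothVFAt ((crd u).symm z) X) : ContDiffAt ℝ ∞ (rep u X) z := by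
  have : IsManifold (𝓡 n).tangent 1 (TanB n M) := IsManifold.of_le (n := ∞) (by simp)
  have h := ContMDiffAt.mpullback_vectorField_preimage (n := ∞) hX (contMDiffAt_crd_symm hz)
    (isInvertible_mfderiv_symm hz) (by simp)
  exact (contMDiffAt_vectorSpace_iff_contDiffAt.1 h).congr_of_eventuallyEq
    (mpullback_symm_eventuallyEq_rep hz X).symm

theorem smoothVFAt_ofRep {u w : TanB n M} (hw : w ∈ (crd u).source) {Y : Coord n → Coord n}
    (hY : ContDiffAt ℝ ∞ Y (crd u w)) : SmoothVFAt w (ofRep u Y) := by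
  have : IsManifold (𝓡 n).tangent 1 (TanB n M) := IsManifold.of_le (n := ∞) (by simp)
  exact ContMDiffAt.mpullback_vectorField_preimage (n := ∞)
    (contMDiffAt_vectorSpace_iff_contDiffAt.2 hY) (contMDiffAt_crd hw)
    (isInvertible_dcrd hw) (by simp)

theorem ofRep_rep {u w : TanB n M} (hw : w ∈ (crd u).source) (X : VF n M) :
    ofRep u (rep u X) w = X w := by
  have h := (isInvertible_dcrd hw)
  simp only [rep, ofRep]
  rw [(crd u).left_inv hw]
  exact h.inverse_apply_self _

/-- Naturality of the Lie bracket under pullback by the inverse chart: the pullback of a field is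
its coordinate expression. -/
theorem rep_bracket {u : TanB n M} {z : Coord n} (hz : z ∈ (crd u).target) {X Y : VF n M}
    (hX : SmoothVFAt ((crd u).symm z) X) (hY : SmoothVFAt ((crd u).symm z) Y) :
    rep u (bracket X Y) z = VectorField.lieBracket ℝ (rep u X) (rep u Y) z := by
  have : IsManifold (𝓡 n).tangent (minSmoothness ℝ 2) (TanB n M) :=
    IsManifold.of_le (n := ∞) minSmoothness_two_le_infty
  have h := VectorField.mpullback_mlieBracket (n := ∞) (hX.mdifferentiableAt (by simp))
    (hY.mdifferentiableAt (by simp)) (contMDiffAt_crd_symm hz) minSmoothness_two_le_infty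
  have h2 : ∀ V W : (x : Coord n) → TangentSpace 𝓘(ℝ, Coord n) x,
      VectorField.mlieBracket 𝓘(ℝ, Coord n) V W z = VectorField.lieBracket ℝ V W z := fun V W =>
    (congrFun VectorField.mlieBracketWithin_univ z).symm.trans
      ((congrFun VectorField.mlieBracketWithin_eq_lieBracketWithin z).trans
        (congrFun VectorField.lieBracketWithin_univ z))
  rw [mpullback_symm_eq_rep hz] at h
  refine h.trans ((h2 _ _).trans ?_)
  exact (mpullback_symm_eventuallyEq_rep hz X).lieBracket_vectorField_eq
    (mpullback_symm_eventuallyEq_rep hz Y)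

theorem smoothVFAt_bracket {w : TanB n M} {X Y : VF n M} (hX : SmoothVFAt w X)
    (hY : SmoothVFAt w Y) : SmoothVFAt w (bracket X Y) := by
  have : IsManifold (𝓡 n).tangent (((⊤ : ℕ∞) : ℕ∞ω) + 1) (TanB n M) :=
    IsManifold.of_le (n := ∞) (by simp)
  have : IsManifold (𝓡 n).tangent (minSmoothness ℝ 2) (TanB n M) :=
    IsManifold.of_le (n := ∞) minSmoothness_two_le_infty
  exact ContMDiffAt.mlieBracket_vectorField (n := (⊤ : ℕ∞)) (m := (⊤ : ℕ∞)) hX hY (by simp)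

theorem lieD_eq {u : TanB n M} {z : Coord n} (hz : z ∈ (crd u).target) (X : VF n M)
    {f : TanB n M → ℝ} (hf : MDifferentiableAt (𝓡 n).tangent 𝓘(ℝ, ℝ) f ((crd u).symm z)) :
    lieD X f ((crd u).symm z) = fderiv ℝ (f ∘ (crd u).symm) z (rep u X z) := by
  have h1 : mfderiv 𝓘(ℝ, Coord n) 𝓘(ℝ, ℝ) (f ∘ (crd u).symm) z = _ :=
    mfderiv_comp z hf ((contMDiffAt_crd_symm hz).mdifferentiableAt (by simp))
  rw [← mfderiv_eq_fderiv, h1]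
  have h2 := DFunLike.congr_fun (mfderiv_symm_comp_dcrd hz) (X ((crd u).symm z))
  exact (congrArg (mfderiv (𝓡 n).tangent 𝓘(ℝ, ℝ) f ((crd u).symm z)) h2).symm

end Coordinates

/-! ### Coordinate form of the vertical structure, J and C. -/

section CoordinateExpressions

variable {n : ℕ} {M : Type*} [TopologicalSpace M] [ChartedSpace (EuclideanSpace ℝ (Fin n)) M]
  [IsManifold (𝓡 n) ∞ M]

/-- The coordinate expression of tangent vectors of `M` at the base point of `w`. -/
def fib (u w : TanB n M) : EuclideanSpace ℝ (Fin n) →L[ℝ] EuclideanSpace ℝ (Fin n) :=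
  tangentCoordChange (𝓡 n) w.1 u.1 w.1

theorem crd_mk (u : TanB n M) (w : TanB n M) (v : EuclideanSpace ℝ (Fin n)) :
    crd u (⟨w.1, v⟩ : TanB n M) = ((crd u w).1, fib u w v) := rfl

theorem fib_bijective {u w : TanB n M} (hw : w ∈ (crd u).source) :
    Function.Bijective (fib u w) := by
  rw [mem_source_iff] at hw
  have h1 := mem_extChartAt_source (I := 𝓡 n) w.1
  have hl : ∀ v, tangentCoordChange (𝓡 n) u.1 w.1 w.1 (fib u w v) = v := fun v => by
    rw [fib, tangentCoordChange_comp ⟨⟨h1, hw⟩, h1⟩, tangentCoordChange_self h1]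
  have hr : ∀ v, fib u w (tangentCoordChange (𝓡 n) u.1 w.1 w.1 v) = v := fun v => by
    rw [fib, tangentCoordChange_comp ⟨⟨hw, h1⟩, hw⟩, tangentCoordChange_self hw]
  exact ⟨Function.LeftInverse.injective hl, Function.RightInverse.surjective hr⟩

theorem crd_snd_eq_zero_iff {u w : TanB n M} (hw : w ∈ (crd u).source) :
    (crd u w).2 = 0 ↔ w.2 = 0 := by
  rw [show (crd u w).2 = fib u w w.2 from rfl]
  exact map_eq_zero_iff (fib u w) (fib_bijective hw).1

theorem dcrd_fst {u w : TanB n M} (hw : w ∈ (crd u).source)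
    (ξ : TangentSpace (𝓡 n).tangent w) : (dcrd u w ξ).1 = fib u w (dProj w ξ) := by
  have : IsManifold (𝓡 n) 1 M := IsManifold.of_le (n := ∞) (by simp)
  have hw' := (mem_source_iff u w).1 hw
  have hw'' : w.1 ∈ (chartAt (EuclideanSpace ℝ (Fin n)) u.1).source := by
    rwa [extChartAt_source] at hw'
  have h1 : mfderiv (𝓡 n).tangent 𝓘(ℝ, EuclideanSpace ℝ (Fin n))
      (fun w => (crd u w).1) w = (ContinuousLinearMap.fst ℝ _ _).comp (dcrd u w) := by
    have h := mfderiv_comp w (g := (Prod.fst : Coord n → EuclideanSpace ℝ (Fin n)))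
      (I' := 𝓘(ℝ, Coord n)) (I'' := 𝓘(ℝ, EuclideanSpace ℝ (Fin n)))
      ((contDiff_fst (n := 1)).contMDiff.contMDiffAt.mdifferentiableAt one_ne_zero)
      ((contMDiffAt_crd hw).mdifferentiableAt (by simp))
    rw [mfderiv_eq_fderiv, fderiv_fst] at h
    exact h
  have h2 : mfderiv (𝓡 n).tangent (𝓡 n)
      (fun w : TanB n M => chartAt (EuclideanSpace ℝ (Fin n)) u.1 w.1) w =
      (mfderiv (𝓡 n) (𝓡 n) (chartAt (EuclideanSpace ℝ (Fin n)) u.1) w.1).comp (dProj w) :=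
    mfderiv_comp w (mdifferentiableAt_atlas (ChartedSpace.chart_mem_atlas _) hw'')
      (Bundle.mdifferentiableAt_proj _)
  rw [mfderiv_chartAt_eq_tangentCoordChange hw''] at h2
  exact DFunLike.congr_fun (h1.symm.trans h2) ξ

theorem contMDiff_fibreInclusion (w : TanB n M) :
    ContMDiff 𝓘(ℝ, EuclideanSpace ℝ (Fin n)) (𝓡 n).tangent ∞
      (fun v : EuclideanSpace ℝ (Fin n) => (⟨w.1, v⟩ : TanB n M)) := by
  intro v
  have hs : ∀ v : EuclideanSpace ℝ (Fin n), (⟨w.1, v⟩ : TanB n M) ∈ (crd w).source := fun v => by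
    rw [mem_source_iff]; exact mem_extChartAt_source _
  have h1 : (fun v : EuclideanSpace ℝ (Fin n) => (⟨w.1, v⟩ : TanB n M)) =
      (crd w).symm ∘ fun v => ((crd w w).1, fib w w v) := by
    ext1 v
    rw [Function.comp_apply, ← crd_mk, (crd w).left_inv (hs v)]
  rw [h1]
  refine ContMDiffAt.comp (I' := 𝓘(ℝ, Coord n)) v ?_ ?_
  · exact contMDiffAt_crd_symm (by rw [← crd_mk]; exact (crd w).map_source (hs v))
  · exact (contDiff_const.prodMk (fib w w).contDiff).contMDiff.contMDiffAt

/-- In coordinates the inclusion of the fibre is affine: its first component is constant and its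
second is the linear map `fib u w`. -/
theorem dcrd_vertLift {u w : TanB n M} (hw : w ∈ (crd u).source)
    (v : EuclideanSpace ℝ (Fin n)) :
    dcrd u w (vertLift w v) = (0, fib u w v) := by
  have h := mfderiv_comp (I' := (𝓡 n).tangent) (I'' := 𝓘(ℝ, Coord n)) (g := crd u)
    (f := fun v : EuclideanSpace ℝ (Fin n) => (⟨w.1, v⟩ : TanB n M)) w.2
    ((contMDiffAt_crd hw).mdifferentiableAt (by simp))
    ((contMDiff_fibreInclusion w).contMDiffAt.mdifferentiableAt (by simp))
  have h1 : ∀ y : EuclideanSpace ℝ (Fin n), HasMFDerivAt 𝓘(ℝ, EuclideanSpace ℝ (Fin n))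
      𝓘(ℝ, Coord n) (crd u ∘ fun v : EuclideanSpace ℝ (Fin n) => (⟨w.1, v⟩ : TanB n M)) y
      ((0 : EuclideanSpace ℝ (Fin n) →L[ℝ] EuclideanSpace ℝ (Fin n)).prod (fib u w)) := fun y =>
    ((hasFDerivAt_const (crd u w).1 y).prodMk (fib u w).hasFDerivAt).hasMFDerivAt
  exact DFunLike.congr_fun (h.symm.trans (h1 w.2).mfderiv) v

theorem dcrd_J {u w : TanB n M} (hw : w ∈ (crd u).source) (X : VF n M) :
    dcrd u w (J X w) = (0, (dcrd u w (X w)).1) := by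
  rw [dcrd_fst hw, J]
  exact dcrd_vertLift hw _

theorem dcrd_liouville {u w : TanB n M} (hw : w ∈ (crd u).source) :
    dcrd u w (liouville w) = (0, (crd u w).2) :=
  dcrd_vertLift hw _

theorem mem_vertical_iff {u w : TanB n M} (hw : w ∈ (crd u).source)
    (ξ : TangentSpace (𝓡 n).tangent w) : ξ ∈ vertical w ↔ (dcrd u w ξ).1 = 0 := by
  rw [dcrd_fst hw]
  exact (map_eq_zero_iff (fib u w) (fib_bijective hw).1).symm

theorem rep_J {u : TanB n M} {z : Coord n} (hz : z ∈ (crd u).target) (X : VF n M) :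
    rep u (J X) z = (0, (rep u X z).1) := dcrd_J ((crd u).map_target hz) X

theorem rep_liouville {u : TanB n M} {z : Coord n} (hz : z ∈ (crd u).target) :
    rep u liouville z = (0, z.2) := by
  rw [rep, dcrd_liouville ((crd u).map_target hz), (crd u).right_inv hz]

theorem isOpen_slit : IsOpen (slit n M) := by
  rw [isOpen_iff_mem_nhds]
  intro u hu
  have hs : u ∈ (crd u).source := mem_extChartAt_source u
  have h1 : ContinuousAt (fun w => (crd u w).2) u :=
    continuous_snd.continuousAt.comp (contMDiffAt_crd hs).continuousAt
  have h2 : (crd u u).2 ≠ 0 := fun h => hu ((crd_snd_eq_zero_iff hs).1 h)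
  filter_upwards [h1.eventually_ne h2, (isOpen_source u).mem_nhds hs] with w hw hws h
  exact hw ((crd_snd_eq_zero_iff hws).2 h)

theorem symm_mem_slit_iff {u : TanB n M} {z : Coord n} (hz : z ∈ (crd u).target) :
    (crd u).symm z ∈ slit n M ↔ z.2 ≠ 0 := by
  have := crd_snd_eq_zero_iff ((crd u).map_target hz)
  rw [(crd u).right_inv hz] at this
  exact this.symm.not

theorem smoothVFAt_of_rep {u : TanB n M} {w : TanB n M} (hw : w ∈ (crd u).source) {X : VF n M}
    (hX : ContDiffAt ℝ ∞ (rep u X) (crd u w)) : SmoothVFAt w X := by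
  refine (smoothVFAt_ofRep hw hX).congr_of_eventuallyEq ?_
  filter_upwards [(isOpen_source u).mem_nhds hw] with x hx
  rw [ofRep_rep hx]

theorem smoothVFAt_J {w : TanB n M} {X : VF n M} (hX : SmoothVFAt w X) : SmoothVFAt w (J X) := by
  have hw : w ∈ (crd w).source := mem_extChartAt_source w
  have hz := (crd w).map_source hw
  refine smoothVFAt_of_rep hw ?_
  have h1 : ContDiffAt ℝ ∞ (rep w X) (crd w w) :=
    contDiffAt_rep hz (by rwa [(crd w).left_inv hw])
  refine ((contDiffAt_const (c := (0 : EuclideanSpace ℝ (Fin n)))).prodMk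
    (contDiff_fst.contDiffAt.comp _ h1)).congr_of_eventuallyEq ?_
  filter_upwards [(isOpen_target w).mem_nhds hz] with y hy using rep_J hy X

theorem smoothVFAt_liouville (w : TanB n M) : SmoothVFAt w (liouville : VF n M) := by
  have hw : w ∈ (crd w).source := mem_extChartAt_source w
  refine smoothVFAt_of_rep hw ?_
  refine ((contDiffAt_const (c := (0 : EuclideanSpace ℝ (Fin n)))).prodMk
    contDiff_snd.contDiffAt).congr_of_eventuallyEq ?_
  filter_upwards [(isOpen_target w).mem_nhds ((crd w).map_source hw)] with y hy
    using rep_liouville hy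

theorem SmoothVFOn.smoothVFAt {U : Set (TanB n M)} {X : VF n M} (hX : SmoothVFOn U X)
    (hU : IsOpen U) {w : TanB n M} (hw : w ∈ U) : SmoothVFAt w X :=
  hX.contMDiffAt (hU.mem_nhds hw)

theorem smoothVFAt_add {w : TanB n M} {X Y : VF n M} (hX : SmoothVFAt w X)
    (hY : SmoothVFAt w Y) : SmoothVFAt w (X + Y) :=
  ContMDiffAt.add_section hX hY

theorem smoothVFAt_sub {w : TanB n M} {X Y : VF n M} (hX : SmoothVFAt w X)
    (hY : SmoothVFAt w Y) : SmoothVFAt w (X - Y) :=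
  ContMDiffAt.sub_section hX hY

theorem smoothVFAt_smul {w : TanB n M} {X : VF n M} (c : ℝ) (hX : SmoothVFAt w X) :
    SmoothVFAt w (c • X) :=
  ContMDiffAt.const_smul_section hX

theorem contDiffAt_comp_symm {u : TanB n M} {z : Coord n} (hz : z ∈ (crd u).target)
    {f : TanB n M → ℝ} (hf : ContMDiffAt (𝓡 n).tangent 𝓘(ℝ, ℝ) ∞ f ((crd u).symm z)) :
    ContDiffAt ℝ ∞ (f ∘ (crd u).symm) z :=
  (hf.comp z (contMDiffAt_crd_symm hz)).contDiffAt

end CoordinateExpressions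

/-! ### Local sprays and the Euler–Lagrange equation in a vector space. -/

section LocalSpray

variable {E : Type*} [NormedAddCommGroup E] [NormedSpace ℝ E]

/-- The coefficients of a spray `yⁱ ∂/∂xⁱ + sⁱ ∂/∂yⁱ` on an open set of a vector space. -/
structure IsLocalSpray (Ω : Set (E × E)) (s : E × E → E) : Prop where
  isOpen : IsOpen Ω
  smooth : ContDiffOn ℝ ∞ s Ω
  euler : ∀ z ∈ Ω, fderiv ℝ s z (0, z.2) = (2 : ℝ) • s z

/-- The vertical component of the horizontal lift of `a`. -/
def hor (s : E × E → E) (z : E × E) : E →L[ℝ] E :=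
  (1 / 2 : ℝ) • (fderiv ℝ s z).comp (ContinuousLinearMap.inr ℝ E E)

theorem hor_apply (s : E × E → E) (z : E × E) (a : E) :
    hor s z a = (1 / 2 : ℝ) • fderiv ℝ s z (0, a) := rfl

theorem fderiv_vertical_eq (s : E × E → E) (z : E × E) (a : E) :
    fderiv ℝ s z (0, a) = (2 : ℝ) • hor s z a := by
  rw [hor_apply, smul_smul]; norm_num

variable {Ω O : Set (E × E)} {s : E × E → E}

theorem IsLocalSpray.differentiableAt (h : IsLocalSpray Ω s) {z : E × E} (hz : z ∈ Ω) :
    DifferentiableAt ℝ s z :=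
  (h.smooth.contDiffAt (h.isOpen.mem_nhds hz)).differentiableAt (by simp)

theorem IsLocalSpray.hor_self (h : IsLocalSpray Ω s) {z : E × E} (hz : z ∈ Ω) :
    hor s z z.2 = s z := by
  rw [hor_apply, h.euler z hz, smul_smul]; norm_num

theorem IsLocalSpray.contDiffOn_fderiv (h : IsLocalSpray Ω s) :
    ContDiffOn ℝ ∞ (fderiv ℝ s) Ω :=
  h.smooth.fderiv_of_isOpen h.isOpen (by simp)

theorem IsLocalSpray.contDiffOn_hor (h : IsLocalSpray Ω s) : ContDiffOn ℝ ∞ (hor s) Ω :=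
  (((ContinuousLinearMap.compL ℝ E (E × E) E).flip
    (ContinuousLinearMap.inr ℝ E E)).contDiff.comp_contDiffOn h.contDiffOn_fderiv).const_smul _

theorem hasFDerivAt_eval_field {G : Type*} [NormedAddCommGroup G] [NormedSpace ℝ G]
    {e : E × E → G} {z : E × E} (he : ContDiffAt ℝ ∞ e z) {X : E × E → E × E}
    (hX : DifferentiableAt ℝ X z) (w : E × E) :
    DifferentiableAt ℝ (fun z => fderiv ℝ e z (X z)) z ∧
    fderiv ℝ (fun z => fderiv ℝ e z (X z)) z w =
      fderiv ℝ (fderiv ℝ e) z w (X z) + fderiv ℝ e z (fderiv ℝ X z w) := by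
  have h1 : HasFDerivAt (fderiv ℝ e) (fderiv ℝ (fderiv ℝ e) z) z :=
    ((he.fderiv_right (m := ∞) (by simp)).differentiableAt (by simp)).hasFDerivAt
  have h2 := h1.clm_apply hX.hasFDerivAt
  refine ⟨h2.differentiableAt, ?_⟩
  rw [h2.fderiv]
  simp [add_comm]

theorem symm_fderiv_fderiv {G : Type*} [NormedAddCommGroup G] [NormedSpace ℝ G] {e : E × E → G}
    {z : E × E} (he : ContDiffAt ℝ ∞ e z) (v w : E × E) :
    fderiv ℝ (fderiv ℝ e) z v w = fderiv ℝ (fderiv ℝ e) z w v :=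
  (he.isSymmSndFDerivAt minSmoothness_two_le_infty).eq v w

theorem hasFDerivAt_vertical (z : E × E) :
    HasFDerivAt (fun z : E × E => ((0 : E), z.2))
      ((0 : E × E →L[ℝ] E).prod (ContinuousLinearMap.snd ℝ E E)) z :=
  (hasFDerivAt_const (0 : E) z).prodMk hasFDerivAt_snd

theorem hasFDerivAt_sprayField {z : E × E} (hs : DifferentiableAt ℝ s z) :
    HasFDerivAt (fun z : E × E => (z.2, s z))
      ((ContinuousLinearMap.snd ℝ E E).prod (fderiv ℝ s z)) z :=
  hasFDerivAt_snd.prodMk hs.hasFDerivAt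

/-- The derivative of the horizontal map in the vertical direction is homogeneous of degree
one. -/
theorem IsLocalSpray.fderiv_hor_euler (h : IsLocalSpray Ω s) {z : E × E} (hz : z ∈ Ω) (a : E) :
    fderiv ℝ (hor s) z (0, z.2) a = hor s z a := by
  have hsz := h.smooth.contDiffAt (h.isOpen.mem_nhds hz)
  have h1 := (hasFDerivAt_eval_field hsz (hasFDerivAt_vertical z).differentiableAt (0, a)).2
  have h2 : (fun z => fderiv ℝ s z (0, z.2)) =ᶠ[𝓝 z] fun z => (2 : ℝ) • s z := by
    filter_upwards [h.isOpen.mem_nhds hz] with x hx using h.euler x hx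
  rw [h2.fderiv_eq, fderiv_fun_const_smul (h.differentiableAt hz),
    (hasFDerivAt_vertical z).fderiv] at h1
  have h3 : DifferentiableAt ℝ (fderiv ℝ s) z :=
    (h.contDiffOn_fderiv.contDiffAt (h.isOpen.mem_nhds hz)).differentiableAt (by simp)
  have h4 : HasFDerivAt (hor s) _ z :=
    ((((ContinuousLinearMap.compL ℝ E (E × E) E).flip
      (ContinuousLinearMap.inr ℝ E E)).hasFDerivAt).comp z h3.hasFDerivAt).const_smul (1 / 2 : ℝ)
  rw [h4.fderiv]
  simp only [ContinuousLinearMap.prod_apply, ContinuousLinearMap.coe_snd',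
    zero_apply, two_smul] at h1
  simp only [smul_apply, ContinuousLinearMap.comp_apply, ContinuousLinearMap.flip_apply,
    ContinuousLinearMap.compL_apply, ContinuousLinearMap.inr_apply, hor_apply]
  rw [symm_fderiv_fderiv hsz]
  rw [← add_right_cancel h1]
  rfl

/-- The derivatives of X cancel between [JX, S] and J[X, S], so [J, S] is tensorial and only the
vertical derivative of s survives. -/
theorem lieBracket_connection {z : E × E} (hs : DifferentiableAt ℝ s z) {X : E × E → E × E}
    (hX : DifferentiableAt ℝ X z) :
    VectorField.lieBracket ℝ (fun z => ((0 : E), (X z).1)) (fun z => (z.2, s z)) z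
      - (0, (VectorField.lieBracket ℝ X (fun z => (z.2, s z)) z).1)
      = ((X z).1, (2 : ℝ) • hor s z (X z).1 - (X z).2) := by
  have h1 : HasFDerivAt (fun z => ((0 : E), (X z).1)) _ z :=
    (hasFDerivAt_const (0 : E) z).prodMk (hasFDerivAt_fst.comp z hX.hasFDerivAt)
  simp only [VectorField.lieBracket, h1.fderiv, (hasFDerivAt_sprayField hs).fderiv]
  ext
  · simp
  · simp [fderiv_vertical_eq]

/-- The horizontal lift is homogeneous of degree one in y, so the flow of C preserves the horizontal
distribution. This makes Hol stable under bracket with C. -/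
theorem IsLocalSpray.lieBracket_vertical_horizontal (h : IsLocalSpray Ω s) {z : E × E}
    (hz : z ∈ Ω) {X : E × E → E × E} (hX : DifferentiableAt ℝ X z)
    (hh : ∀ᶠ z in 𝓝 z, (X z).2 = hor s z (X z).1) :
    (VectorField.lieBracket ℝ (fun z => ((0 : E), z.2)) X z).2 =
      hor s z (VectorField.lieBracket ℝ (fun z => ((0 : E), z.2)) X z).1 := by
  have h1 : HasFDerivAt (hor s) (fderiv ℝ (hor s) z) z :=
    ((h.contDiffOn_hor.contDiffAt (h.isOpen.mem_nhds hz)).differentiableAt (by simp)).hasFDerivAt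
  have h2 : HasFDerivAt (fun z => hor s z (X z).1) _ z :=
    h1.clm_apply (hasFDerivAt_fst.comp z hX.hasFDerivAt)
  have h3 : HasFDerivAt (fun z => (X z).2) _ z := hasFDerivAt_snd.comp z hX.hasFDerivAt
  have h4 := DFunLike.congr_fun (h3.unique (h2.congr_of_eventuallyEq hh)) (0, z.2)
  simp only [ContinuousLinearMap.comp_apply, ContinuousLinearMap.coe_snd', add_apply,
    ContinuousLinearMap.coe_fst', ContinuousLinearMap.flip_apply, h.fderiv_hor_euler hz] at h4
  simp only [VectorField.lieBracket, (hasFDerivAt_vertical z).fderiv]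
  simp [h4, hh.self_of_nhds]

/-- The derivative of the spray along itself of a function, differentiated vertically. -/
theorem IsLocalSpray.fderiv_spray_deriv (h : IsLocalSpray Ω s) {e : E × E → ℝ} {z : E × E}
    (hz : z ∈ Ω) (he : ContDiffAt ℝ ∞ e z) (w : E × E) :
    fderiv ℝ (fun z => fderiv ℝ e z (z.2, s z)) z w =
      fderiv ℝ (fderiv ℝ e) z (z.2, s z) w + fderiv ℝ e z (w.2, fderiv ℝ s z w) := by
  have hS := hasFDerivAt_sprayField (h.differentiableAt hz)
  rw [(hasFDerivAt_eval_field he hS.differentiableAt w).2, symm_fderiv_fderiv he, hS.fderiv]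
  rfl

theorem fderiv_horizontal_eq (e : E × E → ℝ) (z : E × E) (a : E) :
    fderiv ℝ e z (a, fderiv ℝ s z (0, a)) =
      2 * fderiv ℝ e z (a, hor s z a) - fderiv ℝ e z (a, 0) := by
  rw [show (a, fderiv ℝ s z (0, a)) = (2 : ℝ) • ((a, hor s z a) : E × E) - (a, 0) by
    ext
    · simp [two_smul]
    · simp [fderiv_vertical_eq], map_sub, map_smul, smul_eq_mul]

/-- The Euler–Lagrange equations of a `2`-homogeneous energy imply that it is constant along
horizontal curves. -/
theorem IsLocalSpray.horizontal_of_eulerLagrange (h : IsLocalSpray Ω s) (hO : IsOpen O)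
    (hOΩ : O ⊆ Ω) {e : E × E → ℝ} (he : ContDiffOn ℝ ∞ e O)
    (hom : ∀ z ∈ O, fderiv ℝ e z (0, z.2) = 2 * e z)
    (hEL : ∀ z ∈ O, ∀ a, fderiv ℝ (fderiv ℝ e) z (z.2, s z) (0, a) = fderiv ℝ e z (a, 0)) :
    ∀ z ∈ O, ∀ a, fderiv ℝ e z (a, hor s z a) = 0 := by
  have heAt : ∀ z ∈ O, ContDiffAt ℝ ∞ e z := fun z hz => he.contDiffAt (hO.mem_nhds hz)
  have h1 : ∀ z ∈ O, ∀ a, fderiv ℝ (fun z => fderiv ℝ e z (z.2, s z)) z (0, a) =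
      2 * fderiv ℝ e z (a, hor s z a) := by
    intro z hz a
    rw [h.fderiv_spray_deriv (hOΩ hz) (heAt z hz), hEL z hz, fderiv_horizontal_eq]
    ring
  -- Two values for C(Se): the identity `h1` at a = y gives 2 Se, whereas expanding it and using the
  -- 2-homogeneity of e gives 3 Se. Hence Se = 0.
  have hσ : ∀ z ∈ O, fderiv ℝ e z (z.2, s z) = 0 := by
    intro z hz
    have h2 := h1 z hz z.2
    rw [h.hor_self (hOΩ hz)] at h2
    rw [h.fderiv_spray_deriv (hOΩ hz) (heAt z hz), fderiv_horizontal_eq, h.hor_self (hOΩ hz)] at h2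
    have h3 := (hasFDerivAt_eval_field (heAt z hz) (hasFDerivAt_vertical z).differentiableAt
      (z.2, s z)).2
    have h4 : (fun z => fderiv ℝ e z (0, z.2)) =ᶠ[𝓝 z] fun z => 2 * e z := by
      filter_upwards [hO.mem_nhds hz] with x hx using hom x hx
    rw [h4.fderiv_eq, (((heAt z hz).differentiableAt (by simp)).hasFDerivAt.const_mul 2).fderiv,
      (hasFDerivAt_vertical z).fderiv] at h3
    simp only [smul_apply, ContinuousLinearMap.prod_apply, zero_apply,
      ContinuousLinearMap.coe_snd', smul_eq_mul] at h3
    have h5 : fderiv ℝ e z (z.2, s z) = fderiv ℝ e z (z.2, 0) + fderiv ℝ e z (0, s z) := by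
      rw [← map_add]; simp
    linarith
  -- With Se = 0 near z, the left side of `h1` vanishes, which is the claim for every a.
  intro z hz a
  have h2 : (fun z => fderiv ℝ e z (z.2, s z)) =ᶠ[𝓝 z] fun _ => 0 := by
    filter_upwards [hO.mem_nhds hz] with x hx using hσ x hx
  have h3 := h1 z hz a
  rw [h2.fderiv_eq] at h3
  simpa using h3.symm

/-- A function which is constant along horizontal curves solves the Euler–Lagrange equations. -/
theorem IsLocalSpray.eulerLagrange_of_horizontal (h : IsLocalSpray Ω s) (hO : IsOpen O)
    (hOΩ : O ⊆ Ω) {e : E × E → ℝ} (he : ContDiffOn ℝ ∞ e O)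
    (hh : ∀ z ∈ O, ∀ a, fderiv ℝ e z (a, hor s z a) = 0) :
    ∀ z ∈ O, ∀ a, fderiv ℝ (fderiv ℝ e) z (z.2, s z) (0, a) = fderiv ℝ e z (a, 0) := by
  intro z hz a
  have h2 : (fun z => fderiv ℝ e z (z.2, s z)) =ᶠ[𝓝 z] fun _ => 0 := by
    filter_upwards [hO.mem_nhds hz] with x hx
    rw [← h.hor_self (hOΩ hx)]
    exact hh x hx _
  have h3 := h.fderiv_spray_deriv (hOΩ hz) (he.contDiffAt (hO.mem_nhds hz)) (0, a)
  rw [h2.fderiv_eq, fderiv_horizontal_eq, hh z hz] at h3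
  simp only [fderiv_fun_const, Pi.zero_apply, zero_apply] at h3
  linarith

end LocalSpray

/-! ### Sprays, projectors and horizontal fields in coordinates. -/

section SprayCoordinates

variable {n : ℕ} {M : Type*} [TopologicalSpace M] [ChartedSpace (EuclideanSpace ℝ (Fin n)) M]
  [IsManifold (𝓡 n) ∞ M]

/-- The coordinate image of the slit tangent bundle. -/
def slitTarget (u : TanB n M) : Set (Coord n) := (crd u).target ∩ {z | z.2 ≠ 0}

/-- The coefficients of a spray in the coordinates around `u`. -/
def coeff (u : TanB n M) (S : VF n M) : Coord n → EuclideanSpace ℝ (Fin n) :=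
  fun z => (rep u S z).2

theorem isOpen_slitTarget (u : TanB n M) : IsOpen (slitTarget u) :=
  (isOpen_target u).inter (isOpen_ne_fun continuous_snd continuous_const)

theorem symm_mem_slit {u : TanB n M} {z : Coord n} (hz : z ∈ slitTarget u) :
    (crd u).symm z ∈ slit n M := (symm_mem_slit_iff hz.1).2 hz.2

theorem crd_mem_slitTarget {u w : TanB n M} (hw : w ∈ (crd u).source) (hs : w ∈ slit n M) :
    crd u w ∈ slitTarget u :=
  ⟨(crd u).map_source hw, fun h => hs ((crd_snd_eq_zero_iff hw).1 h)⟩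

theorem rep_crd {u w : TanB n M} (hw : w ∈ (crd u).source) (X : VF n M) :
    rep u X (crd u w) = dcrd u w (X w) := by
  rw [rep, (crd u).left_inv hw]

theorem rep_add (u : TanB n M) (X Y : VF n M) (z : Coord n) :
    rep u (X + Y) z = rep u X z + rep u Y z := map_add _ _ _

theorem rep_sub (u : TanB n M) (X Y : VF n M) (z : Coord n) :
    rep u (X - Y) z = rep u X z - rep u Y z := map_sub _ _ _

theorem rep_smul (u : TanB n M) (c : ℝ) (X : VF n M) (z : Coord n) :
    rep u (c • X) z = c • rep u X z :=
  map_smul (dcrd u ((crd u).symm z)) _ _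

theorem eventually_mem_slitTarget {u : TanB n M} {z : Coord n} (hz : z ∈ slitTarget u) :
    ∀ᶠ y in 𝓝 z, y ∈ slitTarget u := (isOpen_slitTarget u).mem_nhds hz

theorem IsSpray.smoothVFAt {S : VF n M} (hS : IsSpray S) {w : TanB n M} (hw : w ∈ slit n M) :
    SmoothVFAt w S := hS.smooth.smoothVFAt isOpen_slit hw

theorem IsSpray.rep_eq {S : VF n M} (hS : IsSpray S) {u : TanB n M} {z : Coord n}
    (hz : z ∈ slitTarget u) : rep u S z = (z.2, coeff u S z) := by
  have h1 := rep_J hz.1 S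
  have h2 : rep u (J S) z = rep u liouville z := by
    rw [rep, rep, hS.J_eq _ (symm_mem_slit hz)]
  rw [h2, rep_liouville hz.1] at h1
  exact Prod.ext (congrArg Prod.snd h1).symm rfl

theorem IsSpray.rep_eventuallyEq {S : VF n M} (hS : IsSpray S) {u : TanB n M} {z : Coord n}
    (hz : z ∈ slitTarget u) : rep u S =ᶠ[𝓝 z] fun z => (z.2, coeff u S z) := by
  filter_upwards [eventually_mem_slitTarget hz] with y hy using hS.rep_eq hy

theorem rep_liouville_eventuallyEq {u : TanB n M} {z : Coord n} (hz : z ∈ (crd u).target) :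
    rep u liouville =ᶠ[𝓝 z] fun z => (0, z.2) := by
  filter_upwards [(isOpen_target u).mem_nhds hz] with y hy using rep_liouville hy

/-- The second component of [C, S] = S reads Ds(0, y) - s = s, the Euler relation of degree two. -/
theorem IsSpray.isLocalSpray {S : VF n M} (hS : IsSpray S) (u : TanB n M) :
    IsLocalSpray (slitTarget u) (coeff u S) := by
  have hsm : ∀ z ∈ slitTarget u, ContDiffAt ℝ ∞ (coeff u S) z := fun z hz =>
    contDiff_snd.contDiffAt.comp z (contDiffAt_rep hz.1 (hS.smoothVFAt (symm_mem_slit hz)))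
  refine ⟨isOpen_slitTarget u, fun z hz => (hsm z hz).contDiffWithinAt, fun z hz => ?_⟩
  have hw := symm_mem_slit hz
  have h1 := rep_bracket hz.1 (smoothVFAt_liouville _) (hS.smoothVFAt hw)
  have h2 : rep u (bracket liouville S) z = rep u S z := by
    rw [rep, rep, hS.homogeneous _ hw]
  rw [h2, (rep_liouville_eventuallyEq hz.1).lieBracket_vectorField_eq (hS.rep_eventuallyEq hz),
    hS.rep_eq hz, VectorField.lieBracket,
    (hasFDerivAt_sprayField ((hsm z hz).differentiableAt (by simp))).fderiv,
    (hasFDerivAt_vertical z).fderiv] at h1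
  have h3 := congrArg Prod.snd h1
  simp only [ContinuousLinearMap.prod_apply, Prod.snd_sub, ContinuousLinearMap.coe_snd'] at h3
  rw [two_smul]
  exact (eq_sub_iff_add_eq.1 h3).symm

theorem IsSpray.rep_Gam {S : VF n M} (hS : IsSpray S) {u : TanB n M} {z : Coord n}
    (hz : z ∈ slitTarget u) {X : VF n M} (hX : SmoothVFAt ((crd u).symm z) X) :
    rep u (Gam S X) z = ((rep u X z).1,
      (2 : ℝ) • hor (coeff u S) z (rep u X z).1 - (rep u X z).2) := by
  have hSs := hS.smoothVFAt (symm_mem_slit hz)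
  have hJ : rep u (J X) =ᶠ[𝓝 z] fun z => (0, (rep u X z).1) := by
    filter_upwards [(isOpen_target u).mem_nhds hz.1] with y hy using rep_J hy X
  rw [Gam, rep_sub, rep_J hz.1, rep_bracket hz.1 (smoothVFAt_J hX) hSs,
    rep_bracket hz.1 hX hSs, hJ.lieBracket_vectorField_eq (hS.rep_eventuallyEq hz),
    EventuallyEq.rfl.lieBracket_vectorField_eq (hS.rep_eventuallyEq hz)]
  exact lieBracket_connection ((hS.isLocalSpray u).differentiableAt hz)
    ((contDiffAt_rep hz.1 hX).differentiableAt (by simp))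

theorem IsSpray.rep_hProj {S : VF n M} (hS : IsSpray S) {u : TanB n M} {z : Coord n}
    (hz : z ∈ slitTarget u) {X : VF n M} (hX : SmoothVFAt ((crd u).symm z) X) :
    rep u (hProj S X) z = ((rep u X z).1, hor (coeff u S) z (rep u X z).1) := by
  rw [hProj, rep_smul, rep_add, hS.rep_Gam hz hX]
  ext1
  · simp only [Prod.smul_fst, Prod.fst_add]; module
  · simp only [Prod.smul_snd, Prod.snd_add]; module

theorem IsSpray.rep_vProj {S : VF n M} (hS : IsSpray S) {u : TanB n M} {z : Coord n}
    (hz : z ∈ slitTarget u) {X : VF n M} (hX : SmoothVFAt ((crd u).symm z) X) :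
    rep u (vProj S X) z = (0, (rep u X z).2 - hor (coeff u S) z (rep u X z).1) := by
  rw [vProj, rep_smul, rep_sub, hS.rep_Gam hz hX]
  ext1
  · simp only [Prod.smul_fst, Prod.fst_sub]; module
  · simp only [Prod.smul_snd, Prod.snd_sub]; module

theorem IsSpray.smoothVFAt_hProj {S : VF n M} (hS : IsSpray S) {w : TanB n M}
    (hw : w ∈ slit n M) {X : VF n M} (hX : SmoothVFAt w X) : SmoothVFAt w (hProj S X) :=
  smoothVFAt_smul _ (smoothVFAt_add hX (smoothVFAt_sub
    (smoothVFAt_bracket (smoothVFAt_J hX) (hS.smoothVFAt hw))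
    (smoothVFAt_J (smoothVFAt_bracket hX (hS.smoothVFAt hw)))))

theorem dcrd_injective {u w : TanB n M} (hw : w ∈ (crd u).source) :
    Function.Injective (dcrd u w) := (isInvertible_dcrd hw).injective

theorem rep_eq_iff {u : TanB n M} {z : Coord n} (hz : z ∈ (crd u).target) {X Y : VF n M} :
    rep u X z = rep u Y z ↔ X ((crd u).symm z) = Y ((crd u).symm z) :=
  (dcrd_injective ((crd u).map_target hz)).eq_iff

theorem IsSpray.hProj_eq_iff {S : VF n M} (hS : IsSpray S) {u : TanB n M} {z : Coord n}
    (hz : z ∈ slitTarget u) {X : VF n M} (hX : SmoothVFAt ((crd u).symm z) X) :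
    hProj S X ((crd u).symm z) = X ((crd u).symm z) ↔
      (rep u X z).2 = hor (coeff u S) z (rep u X z).1 := by
  rw [← rep_eq_iff hz.1, hS.rep_hProj hz hX, Prod.ext_iff]
  simp [eq_comm]

theorem IsHorizontal.smoothVFAt {S X : VF n M} (hX : IsHorizontal S X) {w : TanB n M}
    (hw : w ∈ slit n M) : SmoothVFAt w X := hX.smooth.smoothVFAt isOpen_slit hw

theorem IsHorizontal.rep_snd {S X : VF n M} (hS : IsSpray S) (hX : IsHorizontal S X)
    {u : TanB n M} {z : Coord n} (hz : z ∈ slitTarget u) :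
    (rep u X z).2 = hor (coeff u S) z (rep u X z).1 :=
  (hS.hProj_eq_iff hz (hX.smoothVFAt (symm_mem_slit hz))).1 (hX.h_eq _ (symm_mem_slit hz))

theorem self_mem_source (w : TanB n M) : w ∈ (crd w).source := mem_extChartAt_source w

theorem isHorizontal_of_rep {S X : VF n M} (hS : IsSpray S)
    (hX : ∀ w ∈ slit n M, SmoothVFAt w X)
    (hh : ∀ w ∈ slit n M, (rep w X (crd w w)).2 =
      hor (coeff w S) (crd w w) (rep w X (crd w w)).1) : IsHorizontal S X := by
  refine ⟨fun w hw => (hX w hw).contMDiffWithinAt, fun w hw => ?_⟩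
  have hz := crd_mem_slitTarget (self_mem_source w) hw
  have h1 := (hS.hProj_eq_iff (X := X) hz
    (by rw [(crd w).left_inv (self_mem_source w)]; exact hX w hw)).2 (hh w hw)
  rwa [(crd w).left_inv (self_mem_source w)] at h1

theorem isHorizontal_hProj {S X : VF n M} (hS : IsSpray S)
    (hX : ∀ w ∈ slit n M, SmoothVFAt w X) : IsHorizontal S (hProj S X) := by
  refine isHorizontal_of_rep hS (fun w hw => hS.smoothVFAt_hProj hw (hX w hw)) fun w hw => ?_
  rw [hS.rep_hProj (crd_mem_slitTarget (self_mem_source w) hw)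
    (by rw [(crd w).left_inv (self_mem_source w)]; exact hX w hw)]

theorem isHorizontal_bracket_liouville {S X : VF n M} (hS : IsSpray S) (hX : IsHorizontal S X) :
    IsHorizontal S (bracket liouville X) := by
  refine isHorizontal_of_rep hS
    (fun w hw => smoothVFAt_bracket (smoothVFAt_liouville w) (hX.smoothVFAt hw)) fun w hw => ?_
  have hz := crd_mem_slitTarget (self_mem_source w) hw
  have hXs := hX.smoothVFAt (symm_mem_slit hz)
  rw [rep_bracket hz.1 (smoothVFAt_liouville _) hXs,
    (rep_liouville_eventuallyEq hz.1).lieBracket_vectorField_eq EventuallyEq.rfl]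
  refine (hS.isLocalSpray w).lieBracket_vertical_horizontal hz
    ((contDiffAt_rep hz.1 hXs).differentiableAt (by simp)) ?_
  filter_upwards [eventually_mem_slitTarget hz] with y hy using hX.rep_snd hS hy

/-- A field with constant coordinates is cut off by a bump function of the base point alone. The
bump lives on M, where Hausdorffness keeps its closed support inside the chart, and it is pulled
back along the projection. -/
theorem exists_smooth_extension [T2Space M] (w : TanB n M) (ξ : TangentSpace (𝓡 n).tangent w) :
    ∃ X : VF n M, (∀ v, SmoothVFAt v X) ∧ X w = ξ := by
  let f : SmoothBumpFunction (𝓡 n) w.1 := Classical.choice inferInstance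
  let Y : VF n M := ofRep w (fun _ => dcrd w w ξ)
  refine ⟨fun v => f v.1 • Y v, fun v => ?_, ?_⟩
  · by_cases hv : v.1 ∈ (chartAt (EuclideanSpace ℝ (Fin n)) w.1).source
    · have hv' : v ∈ (crd w).source := by
        rw [mem_source_iff, extChartAt_source]; exact hv
      have h1 : ContMDiffAt (𝓡 n).tangent 𝓘(ℝ, ℝ) ∞ (fun v : TanB n M => f v.1) v :=
        f.contMDiff.contMDiffAt.comp v (Bundle.contMDiff_proj _).contMDiffAt
      exact ContMDiffAt.smul_section h1 (smoothVFAt_ofRep hv' contDiffAt_const)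
    · have hv' : v.1 ∉ tsupport f := fun h => hv (f.tsupport_subset_chartAt_source h)
      have hc : Continuous fun v : TanB n M => v.1 := FiberBundle.continuous_proj _ _
      have h0 : ∀ᶠ x : TanB n M in 𝓝 v, f x.1 = 0 :=
        hc.continuousAt.eventually (notMem_tsupport_iff_eventuallyEq.1 hv')
      have h1 : SmoothVFAt v (0 : VF n M) := by
        exact Bundle.contMDiff_zeroSection ℝ (TangentSpace (𝓡 n).tangent) |>.contMDiffAt
      refine h1.congr_of_eventuallyEq ?_
      filter_upwards [h0] with x hx
      simp [hx]
  · simp only [f.eq_one, one_smul]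
    exact (isInvertible_dcrd (self_mem_source w)).inverse_apply_self _

theorem exists_horizontal_extension [T2Space M] {S : VF n M} (hS : IsSpray S) {u w : TanB n M}
    (hw : w ∈ (crd u).source) (hws : w ∈ slit n M) (a : EuclideanSpace ℝ (Fin n)) :
    ∃ X : VF n M, IsHorizontal S X ∧ dcrd u w (X w) = (a, hor (coeff u S) (crd u w) a) := by
  -- The vertical component 0 is arbitrary: the horizontal projection depends only on the first
  -- component a.
  obtain ⟨X, hX, hXw⟩ := exists_smooth_extension w ((dcrd u w).inverse (a, 0))
  refine ⟨hProj S X, isHorizontal_hProj hS fun v _ => hX v, ?_⟩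
  rw [← rep_crd hw, hS.rep_hProj (crd_mem_slitTarget hw hws) (hX _), rep_crd hw, hXw]
  have h : dcrd u w ((dcrd u w).inverse (a, 0)) = (a, 0) :=
    (isInvertible_dcrd hw).self_apply_inverse _
  rw [h]

end SprayCoordinates

/-! ### Brackets of holonomy fields: involutivity and stability under C. -/

section HolonomyFields

variable {n : ℕ} {M : Type*} [TopologicalSpace M] [ChartedSpace (EuclideanSpace ℝ (Fin n)) M]
  [IsManifold (𝓡 n) ∞ M]

/-- Vector fields which are, on the slit tangent bundle, linear combinations of iterated brackets
of horizontal vector fields. -/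
inductive IsHolField (S : VF n M) : VF n M → Prop
  | of (X : VF n M) : IsHolGenerator S X → IsHolField S X
  | add (X Y : VF n M) : IsHolField S X → IsHolField S Y → IsHolField S (X + Y)
  | smul (c : ℝ) (X : VF n M) : IsHolField S X → IsHolField S (c • X)
  | congr (X Y : VF n M) : IsHolField S X → (∀ w ∈ slit n M, X w = Y w) → IsHolField S Y

variable {S X Y : VF n M}

theorem IsHolGenerator.smoothVFAt (hX : IsHolGenerator S X) {w : TanB n M} (hw : w ∈ slit n M) :
    SmoothVFAt w X := by
  induction hX with
  | horizontal X hX => exact hX.smoothVFAt hw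
  | bracket X Y hX _ ih => exact smoothVFAt_bracket (hX.smoothVFAt hw) ih

theorem SmoothVFAt.congr_slit {w : TanB n M} (hX : SmoothVFAt w X) (hw : w ∈ slit n M)
    (h : ∀ w ∈ slit n M, X w = Y w) : SmoothVFAt w Y := by
  refine ContMDiffAt.congr_of_eventuallyEq hX ?_
  filter_upwards [isOpen_slit.mem_nhds hw] with v hv
  rw [h v hv]

theorem IsHolField.smoothVFAt (hX : IsHolField S X) {w : TanB n M} (hw : w ∈ slit n M) :
    SmoothVFAt w X := by
  induction hX with
  | of X hX => exact hX.smoothVFAt hw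
  | add X Y _ _ h1 h2 => exact smoothVFAt_add h1 h2
  | smul c X _ h => exact smoothVFAt_smul c h
  | congr X Y _ h ih => exact ih.congr_slit hw h

theorem IsHolField.mem_hol (hX : IsHolField S X) {w : TanB n M} (hw : w ∈ slit n M) :
    X w ∈ hol S w := by
  induction hX with
  | of X hX => exact Submodule.subset_span ⟨X, hX, rfl⟩
  | add X Y _ _ h1 h2 => exact Submodule.add_mem _ h1 h2
  | smul c X _ h => exact Submodule.smul_mem _ c h
  | congr X Y _ h ih => rw [← h w hw]; exact ih

theorem IsHolField.sub (hX : IsHolField S X) (hY : IsHolField S Y) : IsHolField S (X - Y) := by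
  have := hX.add _ _ (hY.smul (-1))
  rwa [neg_one_smul, ← sub_eq_add_neg] at this

theorem bracket_congr_slit {X X' Y Y' : VF n M} (hX : ∀ w ∈ slit n M, X w = X' w)
    (hY : ∀ w ∈ slit n M, Y w = Y' w) {w : TanB n M} (hw : w ∈ slit n M) :
    bracket X Y w = bracket X' Y' w :=
  Filter.EventuallyEq.mlieBracket_vectorField_eq
    (by filter_upwards [isOpen_slit.mem_nhds hw] with v hv using hX v hv)
    (by filter_upwards [isOpen_slit.mem_nhds hw] with v hv using hY v hv)

theorem isManifold_two : IsManifold (𝓡 n).tangent 2 (TanB n M) :=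
  IsManifold.of_le (n := ∞) (WithTop.coe_le_coe.2 (le_top (a := (2 : ℕ∞))))

theorem bracket_add_right {X Y Z : VF n M} {w : TanB n M} (hY : SmoothVFAt w Y)
    (hZ : SmoothVFAt w Z) : bracket X (Y + Z) w = bracket X Y w + bracket X Z w := by
  have := isManifold_two (n := n) (M := M)
  exact VectorField.mlieBracket_add_right (hY.mdifferentiableAt (by simp))
    (hZ.mdifferentiableAt (by simp))

theorem bracket_smul_right {X Y : VF n M} (c : ℝ) {w : TanB n M} (hY : SmoothVFAt w Y) :
    bracket X (c • Y) w = c • bracket X Y w := by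
  have := isManifold_two (n := n) (M := M)
  exact VectorField.mlieBracket_const_smul_right (hY.mdifferentiableAt (by simp))

theorem bracket_swap (X Y : VF n M) (w : TanB n M) : bracket X Y w = -bracket Y X w :=
  VectorField.mlieBracket_swap_apply

theorem bracket_jacobi {X Y Z : VF n M} {w : TanB n M} (hX : SmoothVFAt w X)
    (hY : SmoothVFAt w Y) (hZ : SmoothVFAt w Z) :
    bracket X (bracket Y Z) w = bracket (bracket X Y) Z w + bracket Y (bracket X Z) w := by
  have : IsManifold (𝓡 n).tangent (minSmoothness ℝ 3) (TanB n M) := by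
    rw [minSmoothness_of_isRCLikeNormedField]
    exact IsManifold.of_le (n := ∞) (WithTop.coe_le_coe.2 (le_top (a := (3 : ℕ∞))))
  exact VectorField.leibniz_identity_mlieBracket_apply
    (hX.of_le minSmoothness_two_le_infty) (hY.of_le minSmoothness_two_le_infty)
    (hZ.of_le minSmoothness_two_le_infty)

theorem IsHolField.bracket_horizontal (hY : IsHolField S Y) (hX : IsHorizontal S X) :
    IsHolField S (bracket X Y) := by
  induction hY with
  | of Y hY => exact .of _ (.bracket X Y hX hY)
  | add Y Z hY hZ h1 h2 =>
    exact (h1.add _ _ h2).congr _ _ fun w hw =>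
      (bracket_add_right (hY.smoothVFAt hw) (hZ.smoothVFAt hw)).symm
  | smul c Y hY h =>
    exact (h.smul c).congr _ _ fun w hw => (bracket_smul_right c (hY.smoothVFAt hw)).symm
  | congr Y Z _ h ih =>
    exact ih.congr _ _ fun w hw => bracket_congr_slit (fun _ _ => rfl) h hw

/-- Right-nested brackets span a Lie algebra: by Jacobi [[X, X'], Y] = [X, [X', Y]] - [X', [X, Y]],
and the left factor becomes shorter at each step. -/
theorem IsHolGenerator.bracket_holField (hX : IsHolGenerator S X) :
    ∀ Y, IsHolField S Y → IsHolField S (SprayGeometry.bracket X Y) := by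
  induction hX with
  | horizontal X hX => exact fun Y hY => hY.bracket_horizontal hX
  | bracket X X' hX hX' ih =>
    intro Y hY
    refine (((ih Y hY).bracket_horizontal hX).sub (ih _ (hY.bracket_horizontal hX))).congr _ _
      fun w hw => ?_
    rw [Pi.sub_apply, bracket_jacobi (hX.smoothVFAt hw) (hX'.smoothVFAt hw) (hY.smoothVFAt hw),
      add_sub_cancel_right]

/-- Bracket with C is a derivation by Jacobi and sends horizontal fields to horizontal fields, so it
acts on iterated brackets factor by factor. -/
theorem IsHolGenerator.bracket_liouville (hS : IsSpray S) (hX : IsHolGenerator S X) :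
    IsHolField S (SprayGeometry.bracket liouville X) := by
  induction hX with
  | horizontal X hX => exact .of _ (.horizontal _ (isHorizontal_bracket_liouville hS hX))
  | bracket X Y hX hY ih =>
    refine (((IsHolField.of Y hY).bracket_horizontal
      (isHorizontal_bracket_liouville hS hX)).add _ _ (ih.bracket_horizontal hX)).congr _ _
      fun w hw => ?_
    rw [Pi.add_apply, bracket_jacobi (smoothVFAt_liouville w) (hX.smoothVFAt hw)
      (hY.smoothVFAt hw)]

end HolonomyFields

/-! ### Finsler functions in coordinates; their constancy along the holonomy distribution. -/

section FinslerCoordinates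

variable {n : ℕ} {M : Type*} [TopologicalSpace M] [ChartedSpace (EuclideanSpace ℝ (Fin n)) M]
  [IsManifold (𝓡 n) ∞ M] {S : VF n M} {u : TanB n M} {z : Coord n}

theorem eventually_symm_mem {U : Set (TanB n M)} (hz : z ∈ (crd u).target) (hU : IsOpen U)
    (hw : (crd u).symm z ∈ U) : ∀ᶠ y in 𝓝 z, (crd u).symm y ∈ U :=
  (contMDiffAt_crd_symm hz).continuousAt.eventually (hU.mem_nhds hw)

theorem lieD_of_rep (hz : z ∈ (crd u).target) (X : VF n M) {f : TanB n M → ℝ} {h : Coord n → ℝ}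
    (hf : ∀ᶠ y in 𝓝 z, f ((crd u).symm y) = h y) (hh : DifferentiableAt ℝ h z) :
    lieD X f ((crd u).symm z) = fderiv ℝ h z (rep u X z) := by
  have hw := (crd u).map_target hz
  have hc := contMDiffAt_crd hw
  have h1 : f =ᶠ[𝓝 ((crd u).symm z)] h ∘ crd u := by
    have h2 : Tendsto (crd u) (𝓝 ((crd u).symm z)) (𝓝 z) := by
      have := hc.continuousAt.tendsto
      rwa [(crd u).right_inv hz] at this
    filter_upwards [h2.eventually hf, (isOpen_source u).mem_nhds hw] with v hv hvs
    rw [Function.comp_apply, ← hv, (crd u).left_inv hvs]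
  have h2 : MDifferentiableAt (𝓡 n).tangent 𝓘(ℝ, ℝ) f ((crd u).symm z) := by
    refine MDifferentiableAt.congr_of_eventuallyEq ?_ h1
    refine MDifferentiableAt.comp (I' := 𝓘(ℝ, Coord n)) _ ?_ (hc.mdifferentiableAt (by simp))
    rw [(crd u).right_inv hz]
    exact hh.mdifferentiableAt
  rw [lieD_eq hz X h2]
  have h3 : f ∘ (crd u).symm =ᶠ[𝓝 z] h := hf
  rw [h3.fderiv_eq]

/-- The derivatives of X and the terms in its vertical component cancel, so the equation tested on X
sees only the first component of X at z. -/
theorem eulerLagrange_rep (hS : IsSpray S) {U : Set (TanB n M)} (hU : IsOpen U)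
    {E : TanB n M → ℝ} (hE : ContMDiffOn (𝓡 n).tangent 𝓘(ℝ, ℝ) ∞ E U)
    (hz : z ∈ slitTarget u) (hw : (crd u).symm z ∈ U) {X : VF n M}
    (hX : SmoothVFAt ((crd u).symm z) X) :
    ddJ E S X ((crd u).symm z) - lieD X (E - lieD liouville E) ((crd u).symm z) =
      fderiv ℝ (fderiv ℝ (E ∘ (crd u).symm)) z (z.2, coeff u S z) (0, (rep u X z).1) -
        fderiv ℝ (E ∘ (crd u).symm) z ((rep u X z).1, 0) := by
  set e := E ∘ (crd u).symm with he
  have hev : ∀ᶠ y in 𝓝 z, y ∈ slitTarget u ∧ (crd u).symm y ∈ U :=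
    (eventually_mem_slitTarget hz).and (eventually_symm_mem hz.1 hU hw)
  have hes : ContDiffAt ℝ ∞ e z := contDiffAt_comp_symm hz.1 (hE.contMDiffAt (hU.mem_nhds hw))
  have hlie : ∀ Y : VF n M, ∀ᶠ y in 𝓝 z,
      lieD Y E ((crd u).symm y) = fderiv ℝ e y (rep u Y y) := by
    intro Y
    filter_upwards [hev] with y hy
    exact lieD_eq hy.1.1 Y
      ((hE.contMDiffAt (hU.mem_nhds hy.2)).mdifferentiableAt (by simp))
  have hXs : DifferentiableAt ℝ (rep u X) z := (contDiffAt_rep hz.1 hX).differentiableAt (by simp)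
  have hJX : HasFDerivAt (fun z => ((0 : EuclideanSpace ℝ (Fin n)), (rep u X z).1)) _ z :=
    (hasFDerivAt_const _ z).prodMk (hasFDerivAt_fst.comp z hXs.hasFDerivAt)
  have hC := (hasFDerivAt_vertical z).differentiableAt
  have h1 : lieD S (dJ E X) ((crd u).symm z) = _ := lieD_of_rep hz.1 S
    (h := fun z => fderiv ℝ e z (0, (rep u X z).1)) (by
      filter_upwards [hlie (J X), hev] with y hy hy2
      rw [dJ, hy, rep_J hy2.1.1]) (hasFDerivAt_eval_field hes hJX.differentiableAt 0).1
  have h2 : lieD X (dJ E S) ((crd u).symm z) = _ := lieD_of_rep hz.1 X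
    (h := fun z => fderiv ℝ e z (0, z.2)) (by
      filter_upwards [hlie (J S), hev] with y hy hy2
      rw [dJ, hy, rep_J hy2.1.1, hS.rep_eq hy2.1]) (hasFDerivAt_eval_field hes hC 0).1
  have h3 : dJ E (bracket S X) ((crd u).symm z) =
      fderiv ℝ e z (0, (fderiv ℝ (rep u X) z (z.2, coeff u S z)).1 - (rep u X z).2) := by
    rw [dJ, (hlie _).self_of_nhds, rep_J hz.1, rep_bracket hz.1 (hS.smoothVFAt (symm_mem_slit hz))
      hX, (hS.rep_eventuallyEq hz).lieBracket_vectorField_eq EventuallyEq.rfl,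
      VectorField.lieBracket,
      (hasFDerivAt_sprayField ((hS.isLocalSpray u).differentiableAt hz)).fderiv]
    rfl
  have h4 : lieD X (E - lieD liouville E) ((crd u).symm z) = _ := lieD_of_rep hz.1 X
    (h := fun z => e z - fderiv ℝ e z (0, z.2)) (by
      filter_upwards [hlie liouville, hev] with y hy hy2
      rw [Pi.sub_apply, hy, rep_liouville hy2.1.1]; rfl)
    ((hes.differentiableAt (by simp)).sub (hasFDerivAt_eval_field hes hC 0).1)
  have h5 : fderiv ℝ e z (rep u X z) =
      fderiv ℝ e z ((rep u X z).1, 0) + fderiv ℝ e z (0, (rep u X z).2) := by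
    rw [← map_add]; simp
  have h6 : fderiv ℝ e z (0, (fderiv ℝ (rep u X) z (z.2, coeff u S z)).1 - (rep u X z).2) =
      fderiv ℝ e z (0, (fderiv ℝ (rep u X) z (z.2, coeff u S z)).1) -
        fderiv ℝ e z (0, (rep u X z).2) := by
    rw [← map_sub]; simp
  rw [ddJ, Pi.sub_apply, Pi.sub_apply, h1, h2, h3, h4,
    fderiv_fun_sub (hes.differentiableAt (by simp)) (hasFDerivAt_eval_field hes hC 0).1,
    (hasFDerivAt_eval_field hes hJX.differentiableAt _).2, hJX.fderiv, hS.rep_eq hz, sub_apply,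
    h5, h6]
  simp only [ContinuousLinearMap.prod_apply, zero_apply, ContinuousLinearMap.comp_apply,
    ContinuousLinearMap.coe_fst']
  ring

theorem fderiv_lieBracket_eq_zero {V : Type*} [NormedAddCommGroup V] [NormedSpace ℝ V]
    {f : V × V → ℝ} {z : V × V} (hf : ContDiffAt ℝ ∞ f z) {X Y : V × V → V × V}
    (hX : DifferentiableAt ℝ X z) (hY : DifferentiableAt ℝ Y z)
    (hfX : ∀ᶠ y in 𝓝 z, fderiv ℝ f y (X y) = 0) (hfY : ∀ᶠ y in 𝓝 z, fderiv ℝ f y (Y y) = 0) :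
    fderiv ℝ f z (VectorField.lieBracket ℝ X Y z) = 0 := by
  have h1 := (hasFDerivAt_eval_field hf hX (Y z)).2
  have h2 := (hasFDerivAt_eval_field hf hY (X z)).2
  have hX' : (fun y => fderiv ℝ f y (X y)) =ᶠ[𝓝 z] fun _ => 0 := hfX
  have hY' : (fun y => fderiv ℝ f y (Y y)) =ᶠ[𝓝 z] fun _ => 0 := hfY
  rw [hX'.fderiv_eq] at h1
  rw [hY'.fderiv_eq, symm_fderiv_fderiv hf] at h2
  simp only [fderiv_fun_const, Pi.zero_apply, zero_apply] at h1 h2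
  rw [VectorField.lieBracket, map_sub]
  linarith

/-- The coordinate expression of a Finsler function with spray `S`. -/
theorem finsler_rep (hS : IsSpray S) {U : Set (TanB n M)} (hU : IsOpen U)
    (hUs : U ⊆ slit n M) {F : TanB n M → ℝ} (hF : F ∈ finslerFunctions S U) (u : TanB n M) :
    IsOpen ((crd u).target ∩ (crd u).symm ⁻¹' U) ∧
    ContDiffOn ℝ ∞ (F ∘ (crd u).symm) ((crd u).target ∩ (crd u).symm ⁻¹' U) ∧
    ∀ z ∈ (crd u).target ∩ (crd u).symm ⁻¹' U,
      fderiv ℝ (F ∘ (crd u).symm) z (0, z.2) = F ((crd u).symm z) ∧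
      ∀ a, fderiv ℝ (F ∘ (crd u).symm) z (a, hor (coeff u S) z a) = 0 := by
  set O := (crd u).target ∩ (crd u).symm ⁻¹' U with hOdef
  have hO : IsOpen O := by
    rw [isOpen_iff_mem_nhds]
    intro z hz
    exact inter_mem ((isOpen_target u).mem_nhds hz.1) (eventually_symm_mem hz.1 hU hz.2)
  have hOs : O ⊆ slitTarget u := fun z hz => ⟨hz.1, (symm_mem_slit_iff hz.1).1 (hUs hz.2)⟩
  set f := F ∘ (crd u).symm with hf
  have hFs : ∀ z ∈ O, ContMDiffAt (𝓡 n).tangent 𝓘(ℝ, ℝ) ∞ F ((crd u).symm z) := fun z hz =>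
    hF.1.smooth.contMDiffAt (hU.mem_nhds hz.2)
  have hfs : ∀ z ∈ O, ContDiffAt ℝ ∞ f z := fun z hz => contDiffAt_comp_symm hz.1 (hFs z hz)
  have hom : ∀ z ∈ O, fderiv ℝ f z (0, z.2) = f z := by
    intro z hz
    have := hF.1.homogeneous _ hz.2
    rwa [lieD_eq hz.1 _ ((hFs z hz).mdifferentiableAt (by simp)), rep_liouville hz.1] at this
  refine ⟨hO, fun z hz => (hfs z hz).contDiffWithinAt, fun z hz => ⟨hom z hz, ?_⟩⟩
  have hEs : ContMDiffOn (𝓡 n).tangent 𝓘(ℝ, ℝ) ∞ (energy F) U :=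
    contMDiffOn_const.mul (hF.1.smooth.pow 2)
  -- dE = F dF with F > 0, so the vanishing of dE on horizontal vectors passes to dF.
  have hed : ∀ z ∈ O, ∀ w, fderiv ℝ (energy F ∘ (crd u).symm) z w = f z * fderiv ℝ f z w := by
    intro z hz w
    have h1 : HasFDerivAt (energy F ∘ (crd u).symm) _ z :=
      (((hfs z hz).differentiableAt (by simp)).hasFDerivAt.pow 2).const_mul (1 / 2)
    rw [h1.fderiv]
    simp
    ring
  have key := (hS.isLocalSpray u).horizontal_of_eulerLagrange hO hOs
    (e := energy F ∘ (crd u).symm)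
    (fun z hz => (contDiffAt_comp_symm hz.1
      (hEs.contMDiffAt (hU.mem_nhds hz.2))).contDiffWithinAt)
    (fun z hz => by
      rw [hed z hz, hom z hz]
      simp only [Function.comp_apply, energy, f]; ring)
    (fun z hz a => by
      -- The vector equation is recovered by testing on the field with constant coordinates (a, 0).
      have hX : SmoothVFAt ((crd u).symm z) (ofRep u fun _ => (a, 0)) :=
        smoothVFAt_ofRep ((crd u).map_target hz.1) contDiffAt_const
      have h1 := hF.2 _ hz.2 _ hX
      rw [eulerLagrange_rep hS hU hEs (hOs hz) hz.2 hX, rep_ofRep hz.1] at h1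
      exact sub_eq_zero.1 h1)
  intro a
  have h1 := key z hz a
  rw [hed z hz] at h1
  exact (mul_eq_zero.1 h1).resolve_left (hF.1.pos _ hz.2).ne'

theorem lieD_eq_zero_of_isHolGenerator (hS : IsSpray S) {U : Set (TanB n M)} (hU : IsOpen U)
    (hUs : U ⊆ slit n M) {F : TanB n M → ℝ} (hF : F ∈ finslerFunctions S U) {X : VF n M}
    (hX : IsHolGenerator S X) : ∀ w ∈ U, lieD X F w = 0 := by
  -- The induction runs over all points of a chart domain at once, because the bracket step needs
  -- both derivatives of F to vanish near z.
  have key : ∀ u : TanB n M, ∀ z ∈ (crd u).target ∩ (crd u).symm ⁻¹' U,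
      fderiv ℝ (F ∘ (crd u).symm) z (rep u X z) = 0 := by
    intro u
    obtain ⟨hO, hfs, hf⟩ := finsler_rep hS hU hUs hF u
    have hOs : (crd u).target ∩ (crd u).symm ⁻¹' U ⊆ slitTarget u := fun z hz =>
      ⟨hz.1, (symm_mem_slit_iff hz.1).1 (hUs hz.2)⟩
    have hhor : ∀ X, IsHorizontal S X → ∀ z ∈ (crd u).target ∩ (crd u).symm ⁻¹' U,
        fderiv ℝ (F ∘ (crd u).symm) z (rep u X z) = 0 := by
      intro X hX z hz
      have := (hf z hz).2 (rep u X z).1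
      rwa [← hX.rep_snd hS (hOs hz)] at this
    induction hX with
    | horizontal X hX => exact hhor X hX
    | bracket X Y hX hY ih =>
      intro z hz
      have hw := hUs hz.2
      rw [rep_bracket hz.1 (hX.smoothVFAt hw) (hY.smoothVFAt hw)]
      refine fderiv_lieBracket_eq_zero (hfs.contDiffAt (hO.mem_nhds hz))
        ((contDiffAt_rep hz.1 (hX.smoothVFAt hw)).differentiableAt (by simp))
        ((contDiffAt_rep hz.1 (hY.smoothVFAt hw)).differentiableAt (by simp)) ?_ ?_
      · filter_upwards [hO.mem_nhds hz] with y hy using hhor X hX y hy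
      · filter_upwards [hO.mem_nhds hz] with y hy using ih y hy
  intro w hw
  have hs := self_mem_source w
  have h1 := key w (crd w w) ⟨(crd w).map_source hs, by
    rw [mem_preimage, (crd w).left_inv hs]; exact hw⟩
  rw [← lieD_eq ((crd w).map_source hs)] at h1
  · rwa [(crd w).left_inv hs] at h1
  · rw [(crd w).left_inv hs]
    exact (hF.1.smooth.contMDiffAt (hU.mem_nhds hw)).mdifferentiableAt (by simp)

end FinslerCoordinates

/-! ### The distribution V_F, and Finsler functions built from coordinate data. -/

section FinslerDistribution

variable {n : ℕ} {M : Type*} [TopologicalSpace M] [ChartedSpace (EuclideanSpace ℝ (Fin n)) M]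
  [IsManifold (𝓡 n) ∞ M] {S : VF n M} {u w : TanB n M} {F : TanB n M → ℝ} {U : Set (TanB n M)}

/-- The differential of a function on `TM`. -/
def dFun (F : TanB n M → ℝ) (u : TanB n M) : TangentSpace (𝓡 n).tangent u →L[ℝ] ℝ :=
  mfderiv (𝓡 n).tangent 𝓘(ℝ, ℝ) F u

theorem lieD_eq_dFun (X : VF n M) (F : TanB n M → ℝ) (u : TanB n M) :
    lieD X F u = dFun F u (X u) := rfl

theorem dFun_eq_fderiv (hw : w ∈ (crd u).source)
    (hF : MDifferentiableAt (𝓡 n).tangent 𝓘(ℝ, ℝ) F w) (ξ : TangentSpace (𝓡 n).tangent w) :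
    dFun F w ξ = fderiv ℝ (F ∘ (crd u).symm) (crd u w) (dcrd u w ξ) := by
  have hξ : ofRep u (fun _ => dcrd u w ξ) w = ξ := (isInvertible_dcrd hw).inverse_apply_self ξ
  have h := lieD_eq ((crd u).map_source hw) (ofRep u fun _ => dcrd u w ξ)
    (by rwa [(crd u).left_inv hw])
  rw [rep_ofRep ((crd u).map_source hw), (crd u).left_inv hw, lieD_eq_dFun, hξ] at h
  exact h

theorem dFun_liouville (hF : F ∈ finslerFunctions S U) (hw : w ∈ U) :
    dFun F w (liouville w) = F w := hF.1.homogeneous w hw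

theorem hol_le_ker_dFun (hS : IsSpray S) (hU : IsOpen U) (hUs : U ⊆ slit n M)
    (hF : F ∈ finslerFunctions S U) (hw : w ∈ U) :
    hol S w ≤ LinearMap.ker (dFun F w).toLinearMap := by
  refine Submodule.span_le.2 ?_
  rintro _ ⟨X, hX, rfl⟩
  exact lieD_eq_zero_of_isHolGenerator hS hU hUs hF hX w hw

theorem liouville_mem_vertical (w : TanB n M) : liouville w ∈ vertical w := by
  rw [mem_vertical_iff (self_mem_source w), dcrd_liouville (self_mem_source w)]

theorem IsSpray.dcrd_vProj (hS : IsSpray S) (hw : w ∈ (crd u).source) (hs : w ∈ slit n M)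
    {X : VF n M} (hX : SmoothVFAt w X) :
    dcrd u w (vProj S X w) =
      (0, (dcrd u w (X w)).2 - hor (coeff u S) (crd u w) (dcrd u w (X w)).1) := by
  have h := hS.rep_vProj (crd_mem_slitTarget hw hs) (X := X) (by rwa [(crd u).left_inv hw])
  rwa [rep_crd hw, rep_crd hw] at h

/-- By dF(C) = F the correction term removes exactly the dF-component of v, so dF ∘ v_F = 0;
conversely v_F fixes every vertical vector killed by dF. -/
theorem mem_distV_iff [T2Space M] (hS : IsSpray S) (hUs : U ⊆ slit n M)
    (hF : F ∈ finslerFunctions S U) (hw : w ∈ U) (ξ : TangentSpace (𝓡 n).tangent w) :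
    ξ ∈ distV S F w ↔ ξ ∈ vertical w ∧ dFun F w ξ = 0 := by
  have hs := hUs hw
  have hws := self_mem_source w
  constructor
  · intro h
    have hle : distV S F w ≤ vertical w ⊓ LinearMap.ker (dFun F w).toLinearMap := by
      refine Submodule.span_le.2 ?_
      rintro _ ⟨X, hX, rfl⟩
      have hv : vProj S X w ∈ vertical w := by
        rw [mem_vertical_iff hws, hS.dcrd_vProj hws hs hX]
      refine ⟨Submodule.sub_mem _ hv (Submodule.smul_mem _ _ (liouville_mem_vertical w)), ?_⟩
      change dFun F w (vProjF S F X w) = 0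
      rw [vProjF, map_sub, map_smul, dFun_liouville hF hw, lieD_eq_dFun, smul_eq_mul,
        div_mul_cancel₀ _ (hF.1.pos w hw).ne', sub_self]
    exact hle h
  · rintro ⟨hξ, hFξ⟩
    obtain ⟨X, hX, hXw⟩ := exists_smooth_extension w ξ
    refine Submodule.subset_span ⟨X, hX w, ?_⟩
    have h1 : vProj S X w = ξ := by
      apply dcrd_injective hws
      rw [mem_vertical_iff hws] at hξ
      rw [hS.dcrd_vProj hws hs (hX w), hXw, hξ, map_zero, sub_zero]
      exact Prod.ext hξ.symm rfl
    rw [vProjF, lieD_eq_dFun, h1, hFξ, zero_div, zero_smul, sub_zero]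

/-- The Hessian of a function in the second variable. -/
def vertHess {V : Type*} [NormedAddCommGroup V] [NormedSpace ℝ V] (e : V × V → ℝ) (z : V × V) :
    V →L[ℝ] V →L[ℝ] ℝ :=
  ((ContinuousLinearMap.compL ℝ V (V × V) ℝ).flip (.inr ℝ V V)).comp
    ((fderiv ℝ (fderiv ℝ e) z).comp (.inr ℝ V V))

theorem vertHess_apply {V : Type*} [NormedAddCommGroup V] [NormedSpace ℝ V] (e : V × V → ℝ)
    (z : V × V) (a b : V) : vertHess e z a b = fderiv ℝ (fderiv ℝ e) z (0, a) (0, b) := rfl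

theorem fderiv_fderiv_fibre {V : Type*} [NormedAddCommGroup V] [NormedSpace ℝ V] {e : V × V → ℝ}
    {x y : V} (L : V →L[ℝ] V) (he : ContDiffAt ℝ ∞ e (x, L y)) (a b : V) :
    fderiv ℝ (fderiv ℝ fun v => e (x, L v)) y a b = vertHess e (x, L y) (L a) (L b) := by
  let A : V → V × V := fun v => (x, L v)
  let K : V →L[ℝ] V × V := (ContinuousLinearMap.inr ℝ _ _).comp L
  have hA : ∀ v, HasFDerivAt A K v := fun v => (hasFDerivAt_const _ v).prodMk L.hasFDerivAt
  have hd : ∀ᶠ z in 𝓝 (A y), DifferentiableAt ℝ e z := by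
    filter_upwards [(he.of_le (m := 1) (by simp)).eventually (by simp)] with z hz
    exact hz.differentiableAt (by simp)
  have h1 : fderiv ℝ (fun v => e (x, L v)) =ᶠ[𝓝 y] fun v => (fderiv ℝ e (A v)).comp K := by
    filter_upwards [(hA y).continuousAt.eventually hd] with v hdv
    exact (hdv.hasFDerivAt.comp v (hA v)).fderiv
  have h2 : HasFDerivAt (fderiv ℝ e) (fderiv ℝ (fderiv ℝ e) (A y)) (A y) :=
    ((he.fderiv_right (m := ∞) (by simp)).differentiableAt (by simp)).hasFDerivAt
  have h3 : HasFDerivAt (fun v => (fderiv ℝ e (A v)).comp K) _ y :=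
    (h2.comp y (hA y)).clm_comp (hasFDerivAt_const K y)
  rw [h1.fderiv_eq, h3.fderiv]
  simp [vertHess_apply, A, K]

/-- Chart changes are linear on the fibres, so second fibre derivatives transform as a bilinear form
and nondegeneracy can be tested in any chart. -/
theorem fibreHessian_eq_vertHess {E : TanB n M → ℝ} {e : Coord n → ℝ}
    (he : ContDiffAt ℝ ∞ e (crd u w)) (hE : ∀ᶠ z in 𝓝 (crd u w), E ((crd u).symm z) = e z)
    (hw : w ∈ (crd u).source) (a b : EuclideanSpace ℝ (Fin n)) :
    fibreHessian E w a b = vertHess e (crd u w) (fib u w a) (fib u w b) := by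
  have h : ∀ y : EuclideanSpace ℝ (Fin n), w.2 = y →
      (fun v : EuclideanSpace ℝ (Fin n) => E (⟨w.1, v⟩ : TanB n M)) =ᶠ[𝓝 y]
        fun v => e ((crd u w).1, fib u w v) := by
    rintro y rfl
    have hc : Continuous fun v => ((crd u w).1, fib u w v) :=
      continuous_const.prodMk (fib u w).continuous
    have := (hc.tendsto w.2).eventually hE
    filter_upwards [this] with v hv
    have hs : (⟨w.1, v⟩ : TanB n M) ∈ (crd u).source := by
      rw [mem_source_iff] at hw ⊢; exact hw
    exact (congrArg E ((crd u).left_inv hs)).symm.trans hv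
  rw [fibreHessian, (h _ rfl).fderiv.fderiv_eq]
  exact fderiv_fderiv_fibre (fib u w) he a b

/-- A local solution of the metrizability problem in coordinates gives a Finsler function. -/
theorem comp_crd_mem_finslerFunctions (hS : IsSpray S) {O : Set (Coord n)} (hO : IsOpen O)
    (hOs : O ⊆ slitTarget u) {f : Coord n → ℝ} (hf : ContDiffOn ℝ ∞ f O) (hpos : ∀ z ∈ O, 0 < f z)
    (hhom : ∀ z ∈ O, fderiv ℝ f z (0, z.2) = f z)
    (hhor : ∀ z ∈ O, ∀ a, fderiv ℝ f z (a, hor (coeff u S) z a) = 0)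
    (hess : ∀ z ∈ O, Function.Injective (vertHess (fun z => 1 / 2 * f z ^ 2) z)) :
    IsOpen ((crd u).source ∩ crd u ⁻¹' O) ∧
      f ∘ crd u ∈ finslerFunctions S ((crd u).source ∩ crd u ⁻¹' O) := by
  have hUo : IsOpen ((crd u).source ∩ crd u ⁻¹' O) := by
    rw [isOpen_iff_mem_nhds]
    intro w hw
    exact inter_mem ((isOpen_source u).mem_nhds hw.1)
      ((contMDiffAt_crd hw.1).continuousAt.preimage_mem_nhds (hO.mem_nhds hw.2))
  have hfs : ∀ z ∈ O, ContDiffAt ℝ ∞ f z := fun z hz => hf.contDiffAt (hO.mem_nhds hz)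
  have hFs : ContMDiffOn (𝓡 n).tangent 𝓘(ℝ, ℝ) ∞ (f ∘ crd u)
      ((crd u).source ∩ crd u ⁻¹' O) := fun w hw =>
    ((hfs _ hw.2).contMDiffAt.comp w (contMDiffAt_crd hw.1)).contMDiffWithinAt
  have hEs : ContMDiffOn (𝓡 n).tangent 𝓘(ℝ, ℝ) ∞ (energy (f ∘ crd u))
      ((crd u).source ∩ crd u ⁻¹' O) := contMDiffOn_const.mul (hFs.pow 2)
  have hes : ContDiffOn ℝ ∞ (fun z => 1 / 2 * f z ^ 2) O := contDiffOn_const.mul (hf.pow 2)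
  have hev : ∀ z ∈ O, ∀ᶠ y in 𝓝 z, (f ∘ crd u) ((crd u).symm y) = f y := fun z hz => by
    filter_upwards [hO.mem_nhds hz] with y hy
    rw [Function.comp_apply, (crd u).right_inv (hOs hy).1]
  have hevE : ∀ z ∈ O, ∀ᶠ y in 𝓝 z,
      energy (f ∘ crd u) ((crd u).symm y) = 1 / 2 * f y ^ 2 := fun z hz => by
    filter_upwards [hev z hz] with y hy
    rw [energy, hy]
  refine ⟨hUo, ⟨hFs, fun w hw => hpos _ hw.2, fun w hw => ?_, fun w hw a ha => ?_⟩,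
    fun w hw X hX => ?_⟩
  · have h := lieD_of_rep ((crd u).map_source hw.1) liouville (hev _ hw.2)
      ((hfs _ hw.2).differentiableAt (by simp))
    rw [(crd u).left_inv hw.1, rep_liouville ((crd u).map_source hw.1), hhom _ hw.2] at h
    exact h
  · have hfib := fib_bijective hw.1
    have h1 : vertHess (fun z => 1 / 2 * f z ^ 2) (crd u w) (fib u w a) = 0 := by
      ext b
      obtain ⟨b, rfl⟩ := hfib.2 b
      rw [← fibreHessian_eq_vertHess (hes.contDiffAt (hO.mem_nhds hw.2)) (hevE _ hw.2) hw.1, ha]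
      rfl
    exact (map_eq_zero_iff _ hfib.1).1 ((map_eq_zero_iff _ (hess _ hw.2)).1 h1)
  · have hz := (crd u).map_source hw.1
    have h := eulerLagrange_rep hS hUo hEs (hOs hw.2) (X := X)
      (by rw [(crd u).left_inv hw.1]; exact hw) (by rwa [(crd u).left_inv hw.1])
    rw [(crd u).left_inv hw.1] at h
    rw [h]
    have hee : energy (f ∘ crd u) ∘ (crd u).symm =ᶠ[𝓝 (crd u w)] fun z => 1 / 2 * f z ^ 2 :=
      hevE _ hw.2
    rw [hee.fderiv.fderiv_eq, hee.fderiv_eq, sub_eq_zero]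
    refine (hS.isLocalSpray u).eulerLagrange_of_horizontal hO hOs hes (fun z hz a => ?_) _ hw.2 _
    have h1 : HasFDerivAt (fun z => 1 / 2 * f z ^ 2) _ z :=
      (((hfs z hz).differentiableAt (by simp)).hasFDerivAt.pow 2).const_mul (1 / 2)
    rw [h1.fderiv]
    simp [hhor z hz a]

end FinslerDistribution

/-! ### Stability of nondegeneracy under small perturbations. -/

section Perturbation

variable {V : Type*} [NormedAddCommGroup V] [NormedSpace ℝ V]

theorem vertHess_add {e₁ e₂ : V × V → ℝ} {z : V × V} (h₁ : ContDiffAt ℝ ∞ e₁ z)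
    (h₂ : ContDiffAt ℝ ∞ e₂ z) :
    vertHess (fun z => e₁ z + e₂ z) z = vertHess e₁ z + vertHess e₂ z := by
  have hd : ∀ {e : V × V → ℝ}, ContDiffAt ℝ ∞ e z → ∀ᶠ y in 𝓝 z, DifferentiableAt ℝ e y := by
    intro e he
    filter_upwards [(he.of_le (m := 1) (by simp)).eventually (by simp)] with y hy
    exact hy.differentiableAt (by simp)
  have h : fderiv ℝ (fun z => e₁ z + e₂ z) =ᶠ[𝓝 z] fun y => fderiv ℝ e₁ y + fderiv ℝ e₂ y := by
    filter_upwards [hd h₁, hd h₂] with y hy₁ hy₂ using fderiv_fun_add hy₁ hy₂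
  ext a b
  rw [vertHess_apply, h.fderiv_eq, fderiv_fun_add
    ((h₁.fderiv_right (m := ∞) (by simp)).differentiableAt (by simp))
    ((h₂.fderiv_right (m := ∞) (by simp)).differentiableAt (by simp))]
  rfl

theorem vertHess_const_mul (c : ℝ) {e : V × V → ℝ} {z : V × V} :
    vertHess (fun z => c * e z) z = c • vertHess e z := by
  have h1 : fderiv ℝ (fun z => c * e z) = c • fderiv ℝ e := fderiv_const_smul_field (f := e) c
  have h2 := fderiv_const_smul_field (𝕜 := ℝ) (f := fderiv ℝ e) c
  ext a b
  rw [vertHess_apply, h1, h2]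
  rfl

theorem continuousAt_vertHess {e : V × V → ℝ} {z : V × V} (h : ContDiffAt ℝ ∞ e z) :
    ContinuousAt (vertHess e) z := by
  have h1 : ContinuousAt (fderiv ℝ (fderiv ℝ e)) z :=
    ((h.fderiv_right (m := ∞) (by simp)).fderiv_right (m := ∞) (by simp)).continuousAt
  exact continuousAt_const.clm_comp (h1.clm_comp continuousAt_const)

theorem continuous_quadratic {G : Type*} [NormedAddCommGroup G] [NormedSpace ℝ G] (A B C : G) :
    Continuous fun ε : ℝ => A + ε • B + ε ^ 2 • C := by
  fun_prop

/-- Nondegeneracy of the energy is stable under small perturbations `f (1 + ε g)`. -/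
theorem exists_perturbation [FiniteDimensional ℝ V] {O : Set (V × V)} (hO : IsOpen O)
    {z₀ : V × V} (hz₀ : z₀ ∈ O) {f g : V × V → ℝ} (hf : ContDiffOn ℝ ∞ f O)
    (hg : ContDiffOn ℝ ∞ g O) (hpos : 0 < f z₀) (hg0 : g z₀ = 0)
    (hess : Function.Injective (vertHess (fun z => 1 / 2 * f z ^ 2) z₀)) :
    ∃ ε : ℝ, ε ≠ 0 ∧ ∃ O', IsOpen O' ∧ z₀ ∈ O' ∧ O' ⊆ O ∧
      (∀ z ∈ O', 0 < f z * (1 + ε * g z)) ∧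
      ∀ z ∈ O', Function.Injective
        (vertHess (fun z => 1 / 2 * (f z * (1 + ε * g z)) ^ 2) z) := by
  have hfa := hf.contDiffAt (hO.mem_nhds hz₀)
  have hga := hg.contDiffAt (hO.mem_nhds hz₀)
  have h0 : ContDiffAt ℝ ∞ (fun z => 1 / 2 * f z ^ 2) z₀ := contDiffAt_const.mul (hfa.pow 2)
  have h1 : ContDiffAt ℝ ∞ (fun z => f z ^ 2 * g z) z₀ := (hfa.pow 2).mul hga
  have h2 : ContDiffAt ℝ ∞ (fun z => 1 / 2 * (f z ^ 2 * g z ^ 2)) z₀ :=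
    contDiffAt_const.mul ((hfa.pow 2).mul (hga.pow 2))
  -- The perturbed energy is a quadratic polynomial in ε, so its Hessian at z₀ is continuous in ε
  -- and injective at ε = 0; injective maps are open in finite dimension.
  have hexp : ∀ ε : ℝ, vertHess (fun z => 1 / 2 * (f z * (1 + ε * g z)) ^ 2) z₀ =
      vertHess (fun z => 1 / 2 * f z ^ 2) z₀ + ε • vertHess (fun z => f z ^ 2 * g z) z₀ +
        ε ^ 2 • vertHess (fun z => 1 / 2 * (f z ^ 2 * g z ^ 2)) z₀ := by
    intro ε
    rw [← vertHess_const_mul, ← vertHess_const_mul,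
      ← vertHess_add h0 (contDiffAt_const.mul h1),
      ← vertHess_add (h0.add (contDiffAt_const.mul h1)) (contDiffAt_const.mul h2)]
    congr 1
    ext z
    ring
  have hopen := ContinuousLinearMap.isOpen_injective (𝕜 := ℝ) (E := V) (F := V →L[ℝ] ℝ)
  have hε : ∀ᶠ ε : ℝ in 𝓝 0,
      Function.Injective (vertHess (fun z => 1 / 2 * (f z * (1 + ε * g z)) ^ 2) z₀) := by
    have hc : Continuous fun ε : ℝ =>
        vertHess (fun z => 1 / 2 * (f z * (1 + ε * g z)) ^ 2) z₀ := by
      simp only [hexp]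
      exact continuous_quadratic (G := V →L[ℝ] V →L[ℝ] ℝ) _ _ _
    refine hc.continuousAt.eventually (hopen.mem_nhds ?_)
    simpa using hess
  -- The condition holds near 0, hence at some ε ≠ 0; the second use of openness then spreads it
  -- from z₀ to nearby z.
  obtain ⟨ε, hε, hε0⟩ := ((hε.filter_mono nhdsWithin_le_nhds).and
    (self_mem_nhdsWithin (a := (0 : ℝ)) (s := {0}ᶜ))).exists
  have hp : ContDiffAt ℝ ∞ (fun z => f z * (1 + ε * g z)) z₀ :=
    hfa.mul (contDiffAt_const.add (contDiffAt_const.mul hga))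
  have hOe : ∀ᶠ z in 𝓝 z₀, z ∈ O := hO.mem_nhds hz₀
  have hev : ∀ᶠ z in 𝓝 z₀, z ∈ O ∧ 0 < f z * (1 + ε * g z) ∧
      Function.Injective (vertHess (fun z => 1 / 2 * (f z * (1 + ε * g z)) ^ 2) z) :=
    hOe.and ((hp.continuousAt.eventually (lt_mem_nhds (by simpa [hg0] using hpos))).and
        ((continuousAt_vertHess (contDiffAt_const.mul (hp.pow 2))).eventually
          (hopen.mem_nhds hε)))
  obtain ⟨O', hO', hO'o, hz'⟩ := eventually_nhds_iff.1 hev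
  exact ⟨ε, hε0, O', hO'o, hz', fun z hz => (hO' z hz).1, fun z hz => (hO' z hz).2.1,
    fun z hz => (hO' z hz).2.2⟩

end Perturbation

/-! ### Local frames of a regular holonomy distribution. -/

section HolonomyFrame

variable {n : ℕ} {M : Type*} [TopologicalSpace M] [ChartedSpace (EuclideanSpace ℝ (Fin n)) M]
  [IsManifold (𝓡 n) ∞ M] {S : VF n M} {u : TanB n M}

/-- Near each nonzero vector a regular holonomy distribution has a frame consisting of iterated
brackets of horizontal vector fields. -/
theorem exists_holonomy_frame (hreg : HolRegular S) (hu : u ∈ slit n M) :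
    ∃ (k : ℕ) (X : Fin k → VF n M) (N : Set (Coord n)), (∀ i, IsHolGenerator S (X i)) ∧
      IsOpen N ∧ crd u u ∈ N ∧ N ⊆ slitTarget u ∧
      (∀ z ∈ N, LinearIndependent ℝ fun i => rep u (X i) z) ∧
      ∀ Y, IsHolField S Y → ∀ z ∈ N, rep u Y z ∈ Submodule.span ℝ (range fun i => rep u (X i) z) := by
  obtain ⟨k, hk⟩ := hreg
  have hus := self_mem_source u
  have hfd : ∀ w : TanB n M, FiniteDimensional ℝ (TangentSpace (𝓡 n).tangent w) := fun w =>
    inferInstanceAs (FiniteDimensional ℝ (Coord n))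
  -- A basis of Hol(u) is chosen among values of generators; these generators stay independent near
  -- u.
  obtain ⟨f, hfm, hfspan, hfli⟩ := Submodule.exists_fun_fin_finrank_span_eq ℝ
    {ξ : TangentSpace (𝓡 n).tangent u | ∃ X : VF n M, IsHolGenerator S X ∧ X u = ξ}
  choose X hX hXf using hfm
  have hli : LinearIndependent ℝ fun i => rep u (X i) (crd u u) := by
    have h1 := hfli.map' (dcrd u u).toLinearMap (LinearMap.ker_eq_bot.2 (dcrd_injective hus))
    have h2 : (fun i => rep u (X i) (crd u u)) = (dcrd u u).toLinearMap ∘ f := by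
      ext1 i
      rw [rep_crd hus, hXf]
      rfl
    rw [h2]
    exact h1
  have hzs := crd_mem_slitTarget hus hu
  have hev : ∀ᶠ z in 𝓝 (crd u u),
      z ∈ slitTarget u ∧ LinearIndependent ℝ fun i => rep u (X i) z := by
    refine (eventually_mem_slitTarget hzs).and ?_
    have hc : ContinuousAt (fun z i => rep u (X i) z) (crd u u) := continuousAt_pi.2 fun i =>
      (contDiffAt_rep hzs.1 ((hX i).smoothVFAt (symm_mem_slit hzs))).continuousAt
    exact hc.eventually hli.eventually
  obtain ⟨N, hN, hNo, hzN⟩ := eventually_nhds_iff.1 hev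
  refine ⟨_, X, N, hX, hNo, hzN, fun z hz => (hN z hz).1, fun z hz => (hN z hz).2,
    fun Y hY z hz => ?_⟩
  have hzs' := (hN z hz).1
  have hw := symm_mem_slit hzs'
  have hli' : LinearIndependent ℝ fun i => X i ((crd u).symm z) :=
    LinearIndependent.of_comp (dcrd u ((crd u).symm z)).toLinearMap (hN z hz).2
  -- Here regularity enters: independent sections as numerous as the constant rank span Hol at every
  -- nearby point.
  have hspan : Submodule.span ℝ (range fun i => X i ((crd u).symm z)) =
      hol S ((crd u).symm z) := by
    have := hfd ((crd u).symm z)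
    refine Submodule.eq_of_le_of_finrank_eq (Submodule.span_le.2 ?_) ?_
    · rintro _ ⟨i, rfl⟩
      exact (IsHolField.of _ (hX i)).mem_hol hw
    · rw [finrank_span_eq_card hli', Fintype.card_fin, hk _ hw]
      exact hk u hu
  have hYm := hY.mem_hol hw
  rw [← hspan] at hYm
  have h2 := Submodule.mem_map_of_mem (f := (dcrd u ((crd u).symm z)).toLinearMap) hYm
  rw [Submodule.map_span, ← range_comp] at h2
  exact h2

end HolonomyFrame

/-! ### Detecting vectors outside the holonomy distribution. -/

section Characterization

variable {n : ℕ} {M : Type*} [TopologicalSpace M] [ChartedSpace (EuclideanSpace ℝ (Fin n)) M]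
  [IsManifold (𝓡 n) ∞ M] {S : VF n M} {u : TanB n M}

theorem rep_bracket_self {z : Coord n} (hz : z ∈ (crd u).target) {X : VF n M}
    (hX : SmoothVFAt ((crd u).symm z) X) : rep u (bracket X X) z = 0 := by
  rw [rep_bracket hz hX hX, VectorField.lieBracket_self]
  rfl

theorem rep_bracket_swap (X Y : VF n M) (z : Coord n) :
    rep u (bracket X Y) z = -rep u (bracket Y X) z := by
  rw [rep, bracket_swap, map_neg, rep]

/-- A vector tangent to the indicatrix of `F₀` but not to the holonomy distribution is detected by
the differential of some Finsler function of the same spray. -/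
theorem exists_finslerFunction_dFun_ne_zero [T2Space M] (hS : IsSpray S) (hreg : HolRegular S)
    {F₀ : TanB n M → ℝ} (hF₀ : F₀ ∈ finslerFunctions S (slit n M)) (hu : u ∈ slit n M)
    {ξ : TangentSpace (𝓡 n).tangent u} (hξ : ξ ∉ hol S u) (hξ₀ : dFun F₀ u ξ = 0) :
    ∃ (U : Set (TanB n M)) (F : TanB n M → ℝ), IsOpen U ∧ u ∈ U ∧ U ⊆ slit n M ∧
      F ∈ finslerFunctions S U ∧ dFun F u ξ ≠ 0 := by
  obtain ⟨k, X, N, hX, hN, hzN, hNs, hli, hspan⟩ := exists_holonomy_frame hreg hu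
  have hus := self_mem_source u
  have hψ : (crd u).symm (crd u u) = u := (crd u).left_inv hus
  have hF₀m : MDifferentiableAt (𝓡 n).tangent 𝓘(ℝ, ℝ) F₀ u :=
    (hF₀.1.smooth.contMDiffAt (isOpen_slit.mem_nhds hu)).mdifferentiableAt (by simp)
  obtain ⟨-, hfs, hf⟩ := finsler_rep hS isOpen_slit Subset.rfl hF₀ u
  set f₀ := F₀ ∘ (crd u).symm with hf₀
  have hNd : N ⊆ (crd u).target ∩ (crd u).symm ⁻¹' slit n M := fun z hz =>
    ⟨(hNs hz).1, symm_mem_slit (hNs hz)⟩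
  have hpos : 0 < f₀ (crd u u) := hF₀.1.pos _ (hNd hzN).2
  have hφX : ∀ i, fderiv ℝ f₀ (crd u u) (rep u (X i) (crd u u)) = 0 := by
    intro i
    rw [rep_crd hus, hf₀, ← dFun_eq_fderiv hus hF₀m]
    exact hol_le_ker_dFun hS isOpen_slit Subset.rfl hF₀ hu ((IsHolField.of _ (hX i)).mem_hol hu)
  have hφspan : Submodule.span ℝ (range fun i => rep u (X i) (crd u u)) ≤
      LinearMap.ker (fderiv ℝ f₀ (crd u u)).toLinearMap := by
    refine Submodule.span_le.2 ?_
    rintro _ ⟨i, rfl⟩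
    exact hφX i
  have hφC : fderiv ℝ f₀ (crd u u) (rep u liouville (crd u u)) = f₀ (crd u u) := by
    rw [rep_liouville (hNs hzN).1]
    exact (hf _ (hNd hzN)).1
  -- The frame of Hol is enlarged by C so that the first integral is 0-homogeneous and multiplying
  -- F₀ by a function of it keeps degree one.
  let Z : Option (Fin k) → VF n M := fun o => o.elim liouville X
  have hZs : ∀ o, ∀ z ∈ N, SmoothVFAt ((crd u).symm z) (Z o) := by
    rintro (_ | i) z hz
    · exact smoothVFAt_liouville _
    · exact (hX i).smoothVFAt (symm_mem_slit (hNs hz))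
  have hle : ∀ z, Submodule.span ℝ (range fun i => rep u (X i) z) ≤
      Submodule.span ℝ (range fun o => rep u (Z o) z) := fun z =>
    Submodule.span_mono (by rintro _ ⟨i, rfl⟩; exact ⟨some i, rfl⟩)
  have hrange : ∀ z, range (fun o => rep u (Z o) z) =
      insert (rep u liouville z) (range fun i => rep u (X i) z) := by
    intro z
    ext x
    simp [Z, Option.exists, eq_comm]
  -- C is not in Hol: dF₀ kills Hol but dF₀(C) = F₀ > 0.
  have hZli : LinearIndependent ℝ fun o => rep u (Z o) (crd u u) := by
    refine linearIndependent_option.2 ⟨hli _ hzN, fun h => hpos.ne' ?_⟩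
    rw [← hφC]
    exact hφspan h
  have hinv : ∀ i j, ∀ z ∈ N, VectorField.lieBracket ℝ (rep u (Z i)) (rep u (Z j)) z ∈
      Submodule.span ℝ (range fun l => rep u (Z l) z) := by
    intro i j z hz
    rw [← rep_bracket (hNs hz).1 (hZs i z hz) (hZs j z hz)]
    rcases i with _ | i <;> rcases j with _ | j
    · rw [rep_bracket_self (hNs hz).1 (hZs none z hz)]
      exact Submodule.zero_mem _
    · exact hle z (hspan _ ((hX j).bracket_liouville hS) z hz)
    · rw [rep_bracket_swap]
      exact Submodule.neg_mem _ (hle z (hspan _ ((hX i).bracket_liouville hS) z hz))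
    · exact hle z (hspan _ ((hX i).bracket_holField _ (.of _ (hX j))) z hz)
  have hξ₀' : fderiv ℝ f₀ (crd u u) (dcrd u u ξ) = 0 := by
    rw [hf₀, ← dFun_eq_fderiv hus hF₀m, hξ₀]
  -- If ξ = cC + η with η in Hol, then 0 = dF₀(ξ) = cF₀ forces c = 0 and ξ in Hol. This is where
  -- dF₀(ξ) = 0 is needed.
  have hξN : dcrd u u ξ ∉ Submodule.span ℝ (range fun o => rep u (Z o) (crd u u)) := by
    intro h
    rw [hrange, Submodule.mem_span_insert] at h
    obtain ⟨c, η, hη, hc⟩ := h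
    have h1 : c * f₀ (crd u u) = 0 := by
      have h2 : fderiv ℝ f₀ (crd u u) η = 0 := hφspan hη
      rw [hc, map_add, map_smul, hφC, h2, add_zero] at hξ₀'
      exact hξ₀'
    rw [(mul_eq_zero.1 h1).resolve_right hpos.ne', zero_smul, zero_add] at hc
    have hmap : Submodule.span ℝ (range fun i => rep u (X i) (crd u u)) ≤
        (hol S u).map (dcrd u u).toLinearMap := by
      refine Submodule.span_le.2 ?_
      rintro _ ⟨i, rfl⟩
      exact ⟨X i u, (IsHolField.of _ (hX i)).mem_hol hu, (rep_crd hus _).symm⟩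
    obtain ⟨ζ, hζ, hζη⟩ := hmap hη
    have : ξ = ζ := dcrd_injective hus (hc.trans hζη.symm)
    exact hξ (this ▸ hζ)
  obtain ⟨O, g, hO, hzO, hON, hg, hg0, hgZ, hgξ⟩ := exists_firstIntegral hN hzN
    (fun i z hz => (contDiffAt_rep (hNs hz).1 (hZs i z hz)).contDiffWithinAt) hZli hinv hξN
  -- Every horizontal vector is the value of a global horizontal field, hence lies in the span of
  -- the frame, along which g is constant.
  have hghor : ∀ z ∈ O, ∀ a, fderiv ℝ g z (a, hor (coeff u S) z a) = 0 := by
    intro z hz a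
    have hzs := hNs (hON hz)
    obtain ⟨Y, hY, hYz⟩ := exists_horizontal_extension hS ((crd u).map_target hzs.1)
      (symm_mem_slit hzs) a
    rw [(crd u).right_inv hzs.1] at hYz
    have h1 : Submodule.span ℝ (range fun i => rep u (X i) z) ≤
        LinearMap.ker (fderiv ℝ g z).toLinearMap := by
      refine Submodule.span_le.2 ?_
      rintro _ ⟨i, rfl⟩
      exact hgZ z hz (some i)
    rw [← hYz]
    exact h1 (hspan Y (.of _ (.horizontal _ hY)) z (hON hz))
  have hgC : ∀ z ∈ O, fderiv ℝ g z (0, z.2) = 0 := by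
    intro z hz
    rw [← rep_liouville (hNs (hON hz)).1]
    exact hgZ z hz none
  have hess : Function.Injective (vertHess (fun z => 1 / 2 * f₀ z ^ 2) (crd u u)) := by
    have hfib := fib_bijective hus
    have hfa := hfs.contDiffAt (mem_of_superset (hN.mem_nhds hzN) hNd)
    refine (injective_iff_map_eq_zero _).2 fun a ha => ?_
    obtain ⟨a, rfl⟩ := hfib.2 a
    rw [hF₀.1.nondegenerate u hu a fun b => ?_, map_zero]
    rw [fibreHessian_eq_vertHess (e := fun z => 1 / 2 * f₀ z ^ 2)
      (contDiffAt_const.mul (hfa.pow 2)) (Eventually.of_forall fun z => rfl) hus, ha]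
    rfl
  have hfO : ContDiffOn ℝ ∞ f₀ O := hfs.mono (hON.trans hNd)
  obtain ⟨ε, hε, O', hO', hzO', hO'O, hpos', hess'⟩ :=
    exists_perturbation hO hzO hfO hg hpos hg0 hess
  have hd : ∀ z ∈ O, ∀ η, fderiv ℝ (fun z => f₀ z * (1 + ε * g z)) z η =
      f₀ z * (ε * fderiv ℝ g z η) + (1 + ε * g z) * fderiv ℝ f₀ z η := by
    intro z hz η
    have h1 := ((hfO.contDiffAt (hO.mem_nhds hz)).differentiableAt (by simp)).hasFDerivAt
    have h2 := ((hg.contDiffAt (hO.mem_nhds hz)).differentiableAt (by simp)).hasFDerivAt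
    have h3 : HasFDerivAt (fun z => f₀ z * (1 + ε * g z)) _ z :=
      h1.mul ((h2.const_mul ε).const_add 1)
    rw [h3.fderiv]
    simp
  have hfin : ContDiffOn ℝ ∞ (fun z => f₀ z * (1 + ε * g z)) O' :=
    (hfO.mono hO'O).mul (contDiffOn_const.add (contDiffOn_const.mul (hg.mono hO'O)))
  have hO's : O' ⊆ slitTarget u := hO'O.trans (hON.trans hNs)
  obtain ⟨hU, hF⟩ := comp_crd_mem_finslerFunctions hS hO' hO's hfin hpos'
    (fun z hz => by
      rw [hd z (hO'O hz), hgC z (hO'O hz), (hf z (hNd (hON (hO'O hz)))).1]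
      simp only [f₀, Function.comp_apply]
      ring)
    (fun z hz a => by
      rw [hd z (hO'O hz), hghor z (hO'O hz), (hf z (hNd (hON (hO'O hz)))).2 a]
      ring)
    hess'
  refine ⟨_, _, hU, ⟨hus, hzO'⟩, fun w hw h0 => (hO's hw.2).2 ((crd_snd_eq_zero_iff hw.1).2 h0),
    hF, ?_⟩
  have hFm := (hF.1.smooth.contMDiffAt (hU.mem_nhds ⟨hus, hzO'⟩)).mdifferentiableAt (by simp)
  have hev : ((fun z => f₀ z * (1 + ε * g z)) ∘ crd u) ∘ (crd u).symm =ᶠ[𝓝 (crd u u)]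
      fun z => f₀ z * (1 + ε * g z) := by
    filter_upwards [(isOpen_target u).mem_nhds (hNs hzN).1] with z hz
    simp only [Function.comp_apply, (crd u).right_inv hz]
  -- Since dF₀(ξ) = 0, only the term F₀ ε dg(ξ) remains.
  rw [dFun_eq_fderiv hus hFm, hev.fderiv_eq, hd _ hzO, hξ₀', mul_zero, add_zero]
  exact mul_ne_zero hpos.ne' (mul_ne_zero hε hgξ)

end Characterization

end SprayGeometry

end

theorem mainTheorem1 {n : ℕ} {M : Type*} [TopologicalSpace M]
    [ChartedSpace (EuclideanSpace ℝ (Fin n)) M] [IsManifold (𝓡 n) ∞ M]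
    [T2Space M] [SigmaCompactSpace M]
    (S : SprayGeometry.VF n M) (hS : SprayGeometry.IsSpray S)
    (hmet : SprayGeometry.IsMetrizable S) (hreg : SprayGeometry.HolRegular S) :
    ∀ u ∈ SprayGeometry.slit n M,
      SprayGeometry.holVert S u =
        ⨅ (U : Set (SprayGeometry.TanB n M)) (_ : IsOpen U) (_ : u ∈ U)
          (_ : U ⊆ SprayGeometry.slit n M)
          (F : SprayGeometry.TanB n M → ℝ) (_ : F ∈ SprayGeometry.finslerFunctions S U),
          SprayGeometry.distV S F u := by
  intro u hu
  obtain ⟨F₀, -, hF₀⟩ := hmet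
  refine le_antisymm ?_ ?_
  · simp only [le_iInf_iff]
    intro U hU huU hUs F hF ξ hξ
    exact (SprayGeometry.mem_distV_iff hS hUs hF huU ξ).2
      ⟨hξ.2, SprayGeometry.hol_le_ker_dFun hS hU hUs hF huU hξ.1⟩
  · intro ξ hξ
    simp only [Submodule.mem_iInf] at hξ
    -- The globally defined F₀ is itself one of the functions in the intersection; it provides
    -- verticality and dF₀(ξ) = 0.
    obtain ⟨hv, h₀⟩ := (SprayGeometry.mem_distV_iff hS Set.Subset.rfl hF₀ hu ξ).1
      (hξ _ SprayGeometry.isOpen_slit hu Set.Subset.rfl F₀ hF₀)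
    refine ⟨?_, hv⟩
    by_contra hhol
    obtain ⟨U, F, hU, huU, hUs, hF, hne⟩ :=
      SprayGeometry.exists_finslerFunction_dFun_ne_zero hS hreg hF₀ hu hhol h₀
    exact hne ((SprayGeometry.mem_distV_iff hS hUs hF huU ξ).1 (hξ U hU huU hUs F hF)).2
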